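/- **Bucket search with Grover's algorithm.** For $\mathbf x\in\mathbb F_2^n$ let $|\mathbf x|$ be the Hamming weight, let $\wedge$ be the bitwise AND, and let $\mathcal S^n_w=\{\mathbf x\in\mathbb F_2^n: |\mathbf x|=w\}$. Let $B,n,w,v,\alpha\in\mathbb N$ and $\mathbf c\in\mathcal S^n_v$ be such that $R:=\{\mathbf x\in\mathcal S^n_w: |\mathbf x\wedge\mathbf c|=\alpha\}$ is non-empty, and let $$p=p(n,w,v,\alpha):=\Pr_{\mathbf x,\mathbf y\in R}\big[|\mathbf x+\mathbf y|=w\big]$$ for independent uniformly random $\mathbf x,\mathbf y\in R$ (this depends on $\mathbf c$ only through $v$). The *bucket search problem* with parameters $(B,n,w,v,\alpha)$ is: given a list $\mathbf x_1,\dots,\mathbf x_B$ of independent uniformly random elements of $R$, find a $(1-o(1))$-fraction of the *solution pairs*, i.e. of the pairs of list positions $i<j$ with $|\mathbf x_i+\mathbf x_j|=w$. *Model.* An algorithm is a sequence of steps on qubits that start in $|0\cdots 0\rangle$. The steps are: elementary gates ($H$, $T$, $X$, CNOT, Toffoli); QRACM operations $|i\rangle|b\rangle\mapsto|i\rangle|b\oplus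 z_i\rangle$, where $z_i$ is the $k$-th bit (with $k$ fixed in the step) of the $i$-th word of a classical memory of $n$-bit words, which holds the input list (addresses outside the memory are left unchanged); resetting a qubit; writing a pair of measured registers to a write-only output, provided that a measured flag qubit is $1$; stopping, provided that a measured qubit is $1$. The time of a run is the number of steps carried out, where a QRACM operation or an output step counts as many steps as the number of qubits it names. **Theorem.** There are constants $C,k$ and a sequence $\varepsilon(n)\to0$ ($n\to\infty$) such that for all $B,n,w,v,\alpha$ there is a quantum algorithm with the following properties for every $\mathbf c\in\mathcal S^n_v$ for which $R$ is non-empty. 1. With probability at least $1-\varepsilon(n)$ over the random list and the measurements, its output consists of solution pairs only and contains at least a $(1-\varepsilon(n))$-fraction of all solution pairs. 2. Its expected time, over the random list and the measurements, is $\tilde O(B^2\sqrt p)$: with $f:=B^2\sqrt p$, it is at most $$C\cdot f\cdot\big(n+\log(2+f)\big)^k .$$ In particular it is at most $f\cdot(\log f)^{O(1)}$ when $f$ is exponential in $n$. 3. It uses a classical memory of exactly $B$ words of $n$ bits (which holds the list), accessed through QRACM of the same size $B$, and no other classical memory apart from the write-only output. 4. It uses at most $C\,(n+\log(2+B))^k$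 qubits, which is $n^{O(1)}$ when $B\le 2^{n^{O(1)}}$. -/

import Mathlib

open Filter Topology
open scoped BigOperators

namespace BucketSearch

/-! ### Hamming space and the bucket search problem -/

/-- The space of binary vectors of length `n`. Bitwise XOR is `+`, bitwise AND is the pointwise
product `*`, and the Hamming weight is Mathlib's `hammingNorm`. -/
abbrev Vec (n : ℕ) : Type := Fin n → ZMod 2

/-- The weight-`w` Hamming sphere. -/
def sphere (n w : ℕ) : Finset (Vec n) :=
  Finset.univ.filter fun x => hammingNorm x = w

/-- The vectors of weight `w` whose overlap with the center `c` is `α`. -/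
def region {n : ℕ} (w α : ℕ) (c : Vec n) : Finset (Vec n) :=
  (sphere n w).filter fun x => hammingNorm (x * c) = α

/-- The probability that two independent uniformly random elements `x, y` of `region w α c`
satisfy `|x + y| = w`. -/
noncomputable def solutionProb {n : ℕ} (w α : ℕ) (c : Vec n) : ℝ :=
  (((region w α c ×ˢ region w α c).filter fun xy => hammingNorm (xy.1 + xy.2) = w).card : ℝ) /
    ((region w α c).card : ℝ) ^ 2

/-- The lists of `B` vectors of the region. Independent uniform sampling of the `B` list
entries is the uniform distribution on this finite set. -/
def bucketLists {n : ℕ} (B w α : ℕ) (c : Vec n) : Finset (Fin B → Vec n) :=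
  Fintype.piFinset fun _ => region w α c

/-- The solution pairs of a list, as (unordered) pairs of list positions `i < j`. -/
def solutions {B n : ℕ} (w : ℕ) (X : Fin B → Vec n) : Finset (ℕ × ℕ) :=
  (Finset.univ.filter fun ij : Fin B × Fin B =>
    ij.1 < ij.2 ∧ hammingNorm (X ij.1 + X ij.2) = w).image fun ij => (ij.1.val, ij.2.val)

/-- The output `out` consists of solution pairs only, and it contains at least a
`(1 - ε)`-fraction of all of them. -/
def Finds {B n : ℕ} (w : ℕ) (X : Fin B → Vec n) (ε : ℝ) (out : List (ℕ × ℕ)) : Prop :=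
  out.toFinset ⊆ solutions w X ∧
    (1 - ε) * ((solutions w X).card : ℝ) ≤ (out.toFinset.card : ℝ)

/-! ### Quantum circuits with quantum random access to classical memory -/

/-- Computational basis states of `q` qubits. -/
abbrev Basis (q : ℕ) : Type := Fin q → Bool

/-- Amplitude vectors on `q` qubits. They are not normalized: the state reached along a sequence
of measurement outcomes carries the probability of these outcomes as its squared norm. -/
abbrev State (q : ℕ) : Type := Basis q → ℂ

/-- The squared norm. -/
noncomputable def sqNorm {q : ℕ} (ψ : State q) : ℝ := ∑ s, ‖ψ s‖ ^ 2

/-- The all-zero basis state. -/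
def zeroState (q : ℕ) : State q := fun s => if s = (fun _ => false) then 1 else 0

/-- The number stored in a register (a list of qubits, least significant bit first). -/
def regVal {q : ℕ} (I : List (Fin q)) (s : Basis q) : ℕ :=
  Nat.ofDigits 2 (I.map fun i => (s i).toNat)

/-- The unitary gates: the elementary gates `H`, `T = diag(1, exp (iπ/4))`, `X`, `CNOT` and
Toffoli, and QRACM operations. The gate `qracm I k t` applies `|i⟩|b⟩ ↦ |i⟩|b ⊕ z_i⟩` to the
address register `I` and the target qubit `t`, where `z_i` is the `k`-th bit of the `i`-th
word of the classical memory (whose words have `n` bits). -/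
inductive Gate (n q : ℕ) : Type
  | had (i : Fin q)
  | phase (i : Fin q)
  | not (i : Fin q)
  | cnot (a t : Fin q) (h : a ≠ t)
  | toffoli (a b t : Fin q) (hab : a ≠ b) (ha : a ≠ t) (hb : b ≠ t)
  | qracm (I : List (Fin q)) (k : Fin n) (t : Fin q) (hI : I.Nodup) (ht : t ∉ I)

/-- The map `|s⟩ ↦ |s with bit t flipped if φ s⟩`, for `φ` not depending on bit `t` (then it
is an involution of the basis). -/
def flipIf {q : ℕ} (t : Fin q) (φ : Basis q → Bool) (ψ : State q) : State q :=
  fun s => ψ (Function.update s t (xor (s t) (φ s)))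

/-- The action of a gate, where the classical memory consists of the `M` words
`mem 0, …, mem (M - 1)`; a QRACM operation acts as the identity on addresses `i ≥ M`. -/
noncomputable def Gate.apply {n q : ℕ} (M : ℕ) (mem : ℕ → Vec n) : Gate n q → State q → State q
  | .had i, ψ => fun s =>
      (ψ (Function.update s i false) +
        (if s i then -1 else 1) * ψ (Function.update s i true)) / (Real.sqrt 2 : ℂ)
  | .phase i, ψ => fun s =>
      (if s i then Complex.exp (Complex.I * (Real.pi / 4 : ℝ)) else 1) * ψ s
  | .not i, ψ => flipIf i (fun _ => true) ψ
  | .cnot a t _, ψ => flipIf t (fun s => s a) ψ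
  | .toffoli a b t _ _ _, ψ => flipIf t (fun s => s a && s b) ψ
  | .qracm I k t _ _, ψ =>
      flipIf t (fun s => decide (regVal I s < M ∧ mem (regVal I s) k = 1)) ψ

/-- The steps of an algorithm:
* `gate g` applies the gate `g`;
* `reset i` measures the qubit `i` and sets it to `0`;
* `emit f I J` measures the flag qubit `f`; if the outcome is `1`, it also measures the two
  registers `I` and `J` and writes the pair of outcomes to the (write-only) output;
* `halt i` measures the qubit `i` and stops the algorithm if the outcome is `1`. -/
inductive Op (n q : ℕ) : Type
  | gate (g : Gate n q)
  | reset (i : Fin q)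
  | emit (f : Fin q) (I J : List (Fin q))
  | halt (i : Fin q)

/-- The cost of a step: `1` for an elementary gate and for the measurement of a qubit; a QRACM
operation is charged the number of qubits it acts on, and `emit` the number of qubits it
names. -/
def Op.cost {n q : ℕ} : Op n q → ℕ
  | .gate (.qracm I _ _ _ _) => I.length + 1
  | .gate _ => 1
  | .reset _ => 1
  | .emit _ I J => 1 + I.length + J.length
  | .halt _ => 1

/-- The part of a state on the basis vectors with property `P` (the unnormalized state after a
measurement with this outcome). -/
noncomputable def proj {q : ℕ} (P : Basis q → Prop) [DecidablePred P] (ψ : State q) : State q :=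
  fun s => if P s then ψ s else 0

/-- The expected value of `F output time` over the measurement outcomes, when the remaining steps
are run from the state `ψ`, with `out` already written and time `τ` already spent. -/
noncomputable def expectFrom {n q : ℕ} (M : ℕ) (mem : ℕ → Vec n) (F : List (ℕ × ℕ) → ℕ → ℝ) :
    List (Op n q) → State q → List (ℕ × ℕ) → ℕ → ℝ
  | [], ψ, out, τ => sqNorm ψ * F out τ
  | .gate g :: L, ψ, out, τ =>
      expectFrom M mem F L (g.apply M mem ψ) out (τ + (Op.gate g).cost)
  | .reset i :: L, ψ, out, τ =>
      expectFrom M mem F L (proj (fun s => s i = false) ψ) out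
          (τ + (Op.reset i : Op n q).cost) +
        expectFrom M mem F L (flipIf i (fun _ => true) (proj (fun s => s i = true) ψ)) out
          (τ + (Op.reset i : Op n q).cost)
  | .emit f I J :: L, ψ, out, τ =>
      expectFrom M mem F L (proj (fun s => s f = false) ψ) out
          (τ + (Op.emit f I J : Op n q).cost) +
        ∑ a ∈ Finset.range (2 ^ I.length), ∑ b ∈ Finset.range (2 ^ J.length),
          expectFrom M mem F L
            (proj (fun s => s f = true ∧ regVal I s = a ∧ regVal J s = b) ψ)
            (out ++ [(a, b)]) (τ + (Op.emit f I J : Op n q).cost)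
  | .halt i :: L, ψ, out, τ =>
      sqNorm (proj (fun s => s i = true) ψ) * F out (τ + (Op.halt i : Op n q).cost) +
        expectFrom M mem F L (proj (fun s => s i = false) ψ) out
          (τ + (Op.halt i : Op n q).cost)

/-- A quantum algorithm with quantum access to a classical memory of `n`-bit words: the number
of qubits, the number of words of the classical memory (all of it accessed through QRACM; there
is no other classical memory), and the sequence of steps. The steps do not depend on the contents
of the memory. -/
structure QAlgorithm (n : ℕ) : Type where
  qubits : ℕ
  words : ℕ
  steps : List (Op n qubits)

/-- The classical memory that holds the list `X`. -/
def load {B n : ℕ} (X : Fin B → Vec n) : ℕ → Vec n :=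
  fun i => if h : i < B then X ⟨i, h⟩ else 0

/-- The expected value of `F output time` when the algorithm is run on the input list `X`. -/
noncomputable def QAlgorithm.expect {B n : ℕ} (A : QAlgorithm n) (X : Fin B → Vec n)
    (F : List (ℕ × ℕ) → ℕ → ℝ) : ℝ :=
  expectFrom A.words (load X) F A.steps (zeroState A.qubits) [] 0

/-- The expected running time on a random list of `B` vectors of the region, over the choice of
the list and the measurement outcomes. -/
noncomputable def QAlgorithm.expectedTime {n : ℕ} (A : QAlgorithm n) (B w α : ℕ) (c : Vec n) : ℝ :=
  Finset.expect (bucketLists B w α c) fun X => A.expect X fun _ τ => (τ : ℝ)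

open Classical in
/-- The probability, over the choice of the random list and the measurement outcomes, that the
algorithm finds a `(1 - ε)`-fraction of the solution pairs (and outputs nothing else). -/
noncomputable def QAlgorithm.successProb {n : ℕ} (A : QAlgorithm n) (B w α : ℕ) (c : Vec n)
    (ε : ℝ) : ℝ :=
  Finset.expect (bucketLists B w α c) fun X =>
    A.expect X fun out _ => if Finds w X ε out then 1 else 0

end BucketSearch

/-!
Grover's search over pairs of addresses, run on a fixed schedule, together with a coupon collector
argument.

*One search.* With `2 ^ l > B`, two address registers of `l` qubits are put into the uniform
superposition over `4 ^ l` pairs `(i, j)`. The pair is a solution if `i < j < B` and the sum of the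
words `i` and `j` has weight `w`. This is recognized by a reversible circuit (`testGates`): QRACM
lookups load the sum of the two words, and an oblivious branching program, with its current state
in one-hot encoding (`programGates`), compares the addresses bit by bit and counts the ones of the
word modulo `n + 1`. The reflection about the uniform superposition uses a second branching program
that recognizes the zero address. Conjugating a `Z` gate by such a circuit is exactly diagonal in
the computational basis, so the ancillas stay clean and the state remains in the plane spanned by
the solutions and the nonsolutions (`applyGates_searchGates`). With `j` iterations the
search outputs each of the `M` solutions with probability `sin² ((2 j + 1) θ) / M`, where
`sin² θ = M / 4 ^ l`, and never anything else (`expectFrom_trial`); resetting all qubits makes the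
searches independent.

*Unknown `M`.* Only the numbers of iterations with `2 j + 1 = 3 ^ i` are used. For some level `i`
the angle `3 ^ i θ` lies in `(π/6, π/2]`, so that the search succeeds with probability at
least `1/4`, and then `9 ^ i` is within constant factors of `4 ^ l / M` (`exists_level`).
Level `i` is repeated about `24 (n + 1) 4 ^ l / 9 ^ i ≥ 8 (n + 1) M` times; each solution is then
missed with probability at most `1 / (n + 1) ^ 2` (`prod_schedule_le`), and Markov's inequality
bounds the probability that too large a fraction is missed. No memory of earlier outputs is needed,
since repetitions in the output do no harm.

*Time.* The expected number of solutions is at most `B² p` (`sum_card_solutions_le`), so by Markov's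
inequality there are fewer than `m = (n + 1) B² p` of them except with probability `1 / (n + 1)`.
Only the levels that are right for some `1 ≤ M ≤ m` are run, and each of them takes time
`√(4 ^ l m)`, which is `B² √p`, up to polynomial factors (`sum_trialCost_schedule_le`). If
`(n + 1) B² p < 1`, a single search may already be too expensive; but then, except with
probability `1 / (n + 1)`, there is no solution, and the algorithm without steps succeeds.

The schedule depends on the center `c` only through `p`, and hence only through the weight of `c`
(`solutionProb_eq_of_hammingNorm_eq`).
-/

namespace BucketSearch

/-! ### Gate sequences -/

/-- The action of a sequence of gates, applied from left to right. -/
noncomputable def applyGates {n q : ℕ} (M : ℕ) (mem : ℕ → Vec n) (gs : List (Gate n q))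
    (ψ : State q) : State q :=
  gs.foldl (fun φ g => g.apply M mem φ) ψ

/-- The total cost of a sequence of gates. -/
def gateCost {n q : ℕ} (gs : List (Gate n q)) : ℕ := (gs.map fun g => (Op.gate g).cost).sum

lemma gateCost_append {n q : ℕ} (gs hs : List (Gate n q)) :
    gateCost (gs ++ hs) = gateCost gs + gateCost hs := by
  simp [gateCost]

lemma gateCost_reverse {n q : ℕ} (gs : List (Gate n q)) : gateCost gs.reverse = gateCost gs := by
  simp [gateCost, List.sum_reverse]

lemma gateCost_flatMap_le {n q : ℕ} {ι : Type*} (l : List ι) (F : ι → List (Gate n q)) (c : ℕ)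
    (h : ∀ i ∈ l, gateCost (F i) ≤ c) : gateCost (l.flatMap F) ≤ l.length * c := by
  induction l with
  | nil => simp [gateCost]
  | cons i l ih =>
    rw [List.flatMap_cons, gateCost_append, List.length_cons, add_mul, one_mul, add_comm]
    exact add_le_add (ih fun j hj => h j (List.mem_cons_of_mem _ hj)) (h i List.mem_cons_self)

lemma applyGates_append {n q : ℕ} (M : ℕ) (mem : ℕ → Vec n) (gs hs : List (Gate n q))
    (ψ : State q) :
    applyGates M mem (gs ++ hs) ψ = applyGates M mem hs (applyGates M mem gs ψ) := by
  simp [applyGates]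

lemma expectFrom_gates {n q : ℕ} (M : ℕ) (mem : ℕ → Vec n) (F : List (ℕ × ℕ) → ℕ → ℝ)
    (gs : List (Gate n q)) (L : List (Op n q)) (ψ : State q) (out : List (ℕ × ℕ)) (τ : ℕ) :
    expectFrom M mem F (gs.map Op.gate ++ L) ψ out τ =
      expectFrom M mem F L (applyGates M mem gs ψ) out (τ + gateCost gs) := by
  induction gs generalizing ψ τ with
  | nil => simp [applyGates, gateCost]
  | cons g gs ih =>
    simp only [List.map_cons, List.cons_append, expectFrom, ih]
    simp [applyGates, gateCost, add_assoc]

/-! ### Reversible gates as permutations of the basis -/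

/-- The gates that permute the computational basis. -/
def Gate.IsReversible {n q : ℕ} : Gate n q → Prop
  | .had _ => False
  | .phase _ => False
  | _ => True

/-- Flip the bit `t` of a basis state. -/
def flipBit {q : ℕ} (t : Fin q) (b : Bool) (s : Basis q) : Basis q :=
  Function.update s t (xor (s t) b)

/-- The permutation of the basis carried out by a reversible gate (the identity for the two other
gates). -/
def Gate.act {n q : ℕ} (M : ℕ) (mem : ℕ → Vec n) : Gate n q → Basis q → Basis q
  | .had _, s => s
  | .phase _, s => s
  | .not i, s => flipBit i true s
  | .cnot a t _, s => flipBit t (s a) s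
  | .toffoli a b t _ _ _, s => flipBit t (s a && s b) s
  | .qracm I k t _ _, s =>
      flipBit t (decide (regVal I s < M ∧ mem (regVal I s) k = 1)) s

lemma flipBit_flipBit {q : ℕ} (t : Fin q) (b : Bool) (s : Basis q) :
    flipBit t b (flipBit t b s) = s := by
  ext x
  by_cases h : x = t
  · subst h; simp [flipBit]
  · simp [flipBit, h]

lemma flipBit_of_ne {q : ℕ} {t x : Fin q} (h : x ≠ t) (b : Bool) (s : Basis q) :
    flipBit t b s x = s x := by
  simp [flipBit, h]

@[simp] lemma flipBit_self {q : ℕ} (t : Fin q) (b : Bool) (s : Basis q) :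
    flipBit t b s t = xor (s t) b := by
  simp [flipBit]

lemma regVal_congr {q : ℕ} {I : List (Fin q)} {s s' : Basis q} (h : ∀ x ∈ I, s x = s' x) :
    regVal I s = regVal I s' := by
  unfold regVal
  congr 1
  exact List.map_congr_left fun x hx => by rw [h x hx]

lemma Gate.act_act {n q : ℕ} (M : ℕ) (mem : ℕ → Vec n) (g : Gate n q) (s : Basis q) :
    g.act M mem (g.act M mem s) = s := by
  cases g with
  | had i => rfl
  | phase i => rfl
  | not i => exact flipBit_flipBit _ _ _
  | cnot a t h =>
    simp only [Gate.act, flipBit_of_ne h, flipBit_flipBit]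
  | toffoli a b t hab ha hb =>
    simp only [Gate.act, flipBit_of_ne ha, flipBit_of_ne hb, flipBit_flipBit]
  | qracm I k t hI ht =>
    have : ∀ b, regVal I (flipBit t b s) = regVal I s := fun b =>
      regVal_congr fun x hx => flipBit_of_ne (fun h : x = t => ht (h ▸ hx)) _ _
    simp only [Gate.act, this, flipBit_flipBit]

lemma Gate.apply_of_isReversible {n q : ℕ} (M : ℕ) (mem : ℕ → Vec n) {g : Gate n q}
    (hg : g.IsReversible) (ψ : State q) (s : Basis q) :
    g.apply M mem ψ s = ψ (g.act M mem s) := by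
  cases g <;> simp_all [Gate.apply, Gate.act, flipIf, flipBit, Gate.IsReversible]

/-- The permutation of the basis carried out by a sequence of reversible gates. -/
def actGates {n q : ℕ} (M : ℕ) (mem : ℕ → Vec n) (gs : List (Gate n q)) (s : Basis q) : Basis q :=
  gs.foldl (fun s g => g.act M mem s) s

lemma actGates_append {n q : ℕ} (M : ℕ) (mem : ℕ → Vec n) (gs hs : List (Gate n q))
    (s : Basis q) :
    actGates M mem (gs ++ hs) s = actGates M mem hs (actGates M mem gs s) := by
  simp [actGates]

lemma actGates_cons {n q : ℕ} (M : ℕ) (mem : ℕ → Vec n) (g : Gate n q) (hs : List (Gate n q))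
    (s : Basis q) :
    actGates M mem (g :: hs) s = actGates M mem hs (g.act M mem s) := by
  simp [actGates]

lemma actGates_reverse {n q : ℕ} (M : ℕ) (mem : ℕ → Vec n) (gs : List (Gate n q)) (s : Basis q) :
    actGates M mem gs.reverse (actGates M mem gs s) = s := by
  induction gs generalizing s with
  | nil => rfl
  | cons g gs ih =>
    rw [List.reverse_cons, actGates_append, actGates_cons _ _ _ gs, ih]
    simp [actGates, Gate.act_act]

/-- The basis permutation of a sequence of gates, which is undone by the reversed sequence. -/
def actEquiv {n q : ℕ} (M : ℕ) (mem : ℕ → Vec n) (gs : List (Gate n q)) : Basis q ≃ Basis q where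
  toFun := actGates M mem gs
  invFun := actGates M mem gs.reverse
  left_inv := actGates_reverse M mem gs
  right_inv s := by
    have := actGates_reverse M mem gs.reverse s
    rwa [List.reverse_reverse] at this

lemma applyGates_actGates {n q : ℕ} (M : ℕ) (mem : ℕ → Vec n) {gs : List (Gate n q)}
    (hgs : ∀ g ∈ gs, g.IsReversible) (ψ : State q) (s : Basis q) :
    applyGates M mem gs ψ (actGates M mem gs s) = ψ s := by
  induction gs generalizing s ψ with
  | nil => rfl
  | cons g gs ih =>
    have h1 : applyGates M mem (g :: gs) ψ = applyGates M mem gs (g.apply M mem ψ) := rfl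
    rw [h1, actGates_cons, ih (fun g' hg' => hgs g' (List.mem_cons_of_mem _ hg')),
      Gate.apply_of_isReversible M mem (hgs g List.mem_cons_self), Gate.act_act]

/-- The Pauli gate `Z`, as the fourth power of `T`. -/
def gateZ {n q : ℕ} (f : Fin q) : List (Gate n q) := List.replicate 4 (.phase f)

lemma applyGates_gateZ {n q : ℕ} (M : ℕ) (mem : ℕ → Vec n) (f : Fin q) (ψ : State q)
    (s : Basis q) :
    applyGates M mem (gateZ f) ψ s = (if s f then -1 else 1) * ψ s := by
  have h : Complex.exp (Complex.I * (Real.pi / 4 : ℝ)) ^ 4 = -1 := by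
    rw [← Complex.exp_nat_mul, ← Complex.exp_pi_mul_I]
    congr 1
    push_cast
    ring
  cases hs : s f
  · simp [applyGates, gateZ, List.replicate, Gate.apply, hs]
  · simp only [applyGates, gateZ, List.replicate, Gate.apply, List.foldl, hs, if_true]
    rw [← h]
    ring

/-- Compute by a reversible circuit `D`, apply the phase `-1` if the qubit `f` is set, and
uncompute. -/
def phaseOracle {n q : ℕ} (D : List (Gate n q)) (f : Fin q) : List (Gate n q) :=
  D ++ gateZ f ++ D.reverse

lemma applyGates_phaseOracle {n q : ℕ} (M : ℕ) (mem : ℕ → Vec n) {D : List (Gate n q)}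
    (hD : ∀ g ∈ D, g.IsReversible) (f : Fin q) (ψ : State q) (s : Basis q) :
    applyGates M mem (phaseOracle D f) ψ s =
      (if actGates M mem D s f then -1 else 1) * ψ s := by
  have h1 := applyGates_actGates M mem (gs := D.reverse)
    (fun g hg => hD g (List.mem_reverse.mp hg))
    (applyGates M mem (gateZ f) (applyGates M mem D ψ)) (actGates M mem D s)
  rw [actGates_reverse, applyGates_gateZ, applyGates_actGates M mem hD] at h1
  rw [phaseOracle, applyGates_append, applyGates_append, h1]

lemma gateCost_phaseOracle {n q : ℕ} (D : List (Gate n q)) (f : Fin q) :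
    gateCost (phaseOracle D f) = 2 * gateCost D + 4 := by
  rw [phaseOracle, gateCost_append, gateCost_append, gateCost_reverse]
  simp [gateCost, gateZ, Op.cost]
  ring

/-! ### Hadamard gates -/

lemma flipBit_true_bij {q : ℕ} (i : Fin q) : Function.Involutive (flipBit i true) :=
  flipBit_flipBit i true

lemma had_apply {n q : ℕ} (M : ℕ) (mem : ℕ → Vec n) (i : Fin q) (ψ : State q) (s : Basis q) :
    (Gate.had i : Gate n q).apply M mem ψ s =
      (ψ (flipBit i true s) + (if s i then -1 else 1) * ψ s) / (Real.sqrt 2 : ℂ) := by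
  simp only [Gate.apply, flipBit]
  cases h : s i
  · have : Function.update s i false = s := by rw [← h]; simp
    simp [this, add_comm]
  · have : Function.update s i true = s := by rw [← h]; simp
    simp [this]

lemma sqrt_two_mul_self : (Real.sqrt 2 : ℂ) * (Real.sqrt 2 : ℂ) = 2 := by
  rw [← Complex.ofReal_mul, Real.mul_self_sqrt (by norm_num)]
  norm_num

lemma had_had {n q : ℕ} (M : ℕ) (mem : ℕ → Vec n) (i : Fin q) (ψ : State q) :
    (Gate.had i : Gate n q).apply M mem ((Gate.had i : Gate n q).apply M mem ψ) = ψ := by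
  have h2 := sqrt_two_mul_self
  have h0 : (Real.sqrt 2 : ℂ) ≠ 0 := fun h => by simp [h] at h2
  ext s
  rw [had_apply, had_apply, had_apply, flipBit_flipBit]
  cases h : s i <;> simp [h] <;> field_simp <;> linear_combination (-ψ s) * h2

/-- The Hadamard gate is symmetric for the bilinear pairing. -/
lemma sum_mul_had {n q : ℕ} (M : ℕ) (mem : ℕ → Vec n) (i : Fin q) (φ ψ : State q) :
    ∑ s, φ s * (Gate.had i : Gate n q).apply M mem ψ s =
      ∑ s, (Gate.had i : Gate n q).apply M mem φ s * ψ s := by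
  simp only [had_apply, mul_div_assoc', div_mul_eq_mul_div, ← Finset.sum_div, mul_add, add_mul,
    Finset.sum_add_distrib]
  congr 2
  · rw [← Equiv.sum_comp (Function.Involutive.toPerm _ (flipBit_true_bij i))]
    simp [flipBit_flipBit]
  · exact Finset.sum_congr rfl fun s _ => by ring

/-- The Hadamard gates on the qubits of a list. -/
def hadamards {n q : ℕ} (I : List (Fin q)) : List (Gate n q) := I.map .had

lemma hadamards_reverse {n q : ℕ} (M : ℕ) (mem : ℕ → Vec n) (I : List (Fin q)) (ψ : State q) :
    applyGates M mem (hadamards I.reverse) (applyGates M mem (hadamards I) ψ) = ψ := by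
  induction I generalizing ψ with
  | nil => rfl
  | cons i I ih =>
    have h1 : applyGates M mem (hadamards (i :: I)) ψ =
        applyGates M mem (hadamards I) ((Gate.had i : Gate n q).apply M mem ψ) := rfl
    have h2 : (hadamards (i :: I).reverse : List (Gate n q)) = hadamards I.reverse ++ [.had i] := by
      simp [hadamards]
    rw [h1, h2, applyGates_append, ih]
    exact had_had M mem i ψ

lemma sum_mul_hadamards {n q : ℕ} (M : ℕ) (mem : ℕ → Vec n) (I : List (Fin q)) (φ ψ : State q) :
    ∑ s, φ s * applyGates M mem (hadamards I) ψ s =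
      ∑ s, applyGates M mem (hadamards I.reverse) φ s * ψ s := by
  induction I generalizing ψ with
  | nil => rfl
  | cons i I ih =>
    have h1 : applyGates M mem (hadamards (i :: I)) ψ =
        applyGates M mem (hadamards I) ((Gate.had i : Gate n q).apply M mem ψ) := rfl
    have h2 : (hadamards (i :: I).reverse : List (Gate n q)) = hadamards I.reverse ++ [.had i] := by
      simp [hadamards]
    rw [h1, h2, applyGates_append, ih, sum_mul_had]
    rfl

lemma applyGates_hadamards_sub {n q : ℕ} (M : ℕ) (mem : ℕ → Vec n) (I : List (Fin q))
    (φ ψ : State q) (c : ℂ) :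
    applyGates M mem (hadamards I) (fun s => φ s - c * ψ s) =
      fun s => applyGates M mem (hadamards I) φ s - c * applyGates M mem (hadamards I) ψ s := by
  induction I generalizing φ ψ with
  | nil => rfl
  | cons i I ih =>
    have h1 : ∀ ψ, applyGates M mem (hadamards (i :: I)) ψ =
        applyGates M mem (hadamards I) ((Gate.had i : Gate n q).apply M mem ψ) := fun _ => rfl
    have h2 : (Gate.had i : Gate n q).apply M mem (fun s => φ s - c * ψ s) =
        fun s => (Gate.had i : Gate n q).apply M mem φ s -
          c * (Gate.had i : Gate n q).apply M mem ψ s := by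
      ext s; simp only [had_apply]; ring
    rw [h1, h1, h1, h2, ih]

/-- The basis states in which all qubits outside `S` are `0`. -/
def cleanStates {q : ℕ} (S : Finset (Fin q)) : Finset (Basis q) :=
  Finset.univ.filter fun s => ∀ x ∉ S, s x = false

lemma mem_cleanStates {q : ℕ} {S : Finset (Fin q)} {s : Basis q} :
    s ∈ cleanStates S ↔ ∀ x ∉ S, s x = false := by
  simp [cleanStates]

/-- The uniform superposition on the qubits of `S`. -/
noncomputable def uniformState {q : ℕ} (S : Finset (Fin q)) : State q :=
  fun s => if s ∈ cleanStates S then ((Real.sqrt 2 : ℂ) ^ S.card)⁻¹ else 0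

lemma had_uniformState {n q : ℕ} (M : ℕ) (mem : ℕ → Vec n) (S : Finset (Fin q)) {i : Fin q}
    (hi : i ∉ S) :
    (Gate.had i : Gate n q).apply M mem (uniformState S) = uniformState (insert i S) := by
  have h0 : (Real.sqrt 2 : ℂ) ≠ 0 := by simp
  ext s
  have key : ∀ b, (flipBit i b s ∈ cleanStates S) ↔
      (s i = b ∧ s ∈ cleanStates (insert i S)) := by
    intro b
    simp only [mem_cleanStates, Finset.mem_insert, not_or]
    constructor
    · intro h
      refine ⟨by simpa using h i hi, fun x hx => ?_⟩
      simpa [flipBit_of_ne hx.1] using h x hx.2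
    · rintro ⟨h1, h2⟩ x hx
      by_cases hxi : x = i
      · subst hxi; simp [h1]
      · rw [flipBit_of_ne hxi]; exact h2 x ⟨hxi, hx⟩
  have key0 : s ∈ cleanStates S ↔ (s i = false ∧ s ∈ cleanStates (insert i S)) := by
    rw [← key false]; simp [flipBit]
  rw [had_apply]
  simp only [uniformState, key, key0, Finset.card_insert_of_notMem hi, pow_succ]
  by_cases hs : s ∈ cleanStates (insert i S) <;> cases h : s i <;>
    simp [hs, div_eq_mul_inv, mul_comm]

lemma hadamards_uniformState {n q : ℕ} (M : ℕ) (mem : ℕ → Vec n) (I : List (Fin q))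
    (S : Finset (Fin q)) (hI : I.Nodup) (hIS : ∀ i ∈ I, i ∉ S) :
    applyGates M mem (hadamards I) (uniformState S) = uniformState (I.toFinset ∪ S) := by
  induction I generalizing S with
  | nil => simp [hadamards, applyGates]
  | cons i I ih =>
    have h1 : applyGates M mem (hadamards (i :: I)) (uniformState S) =
        applyGates M mem (hadamards I)
          ((Gate.had i : Gate n q).apply M mem (uniformState S)) := rfl
    rw [List.nodup_cons] at hI
    rw [h1, had_uniformState M mem S (hIS i List.mem_cons_self), ih _ hI.2]
    · congr 1
      ext x
      simp
    · intro j hj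
      simp only [Finset.mem_insert, not_or]
      exact ⟨fun h => hI.1 (h ▸ hj), hIS j (List.mem_cons_of_mem _ hj)⟩

lemma zeroState_eq {q : ℕ} : zeroState q = uniformState ∅ := by
  ext s
  simp [zeroState, uniformState, mem_cleanStates, funext_iff]

lemma hadamards_zeroState {n q : ℕ} (M : ℕ) (mem : ℕ → Vec n) {I : List (Fin q)}
    (hI : I.Nodup) :
    applyGates M mem (hadamards I) (zeroState q) = uniformState I.toFinset := by
  rw [zeroState_eq, hadamards_uniformState M mem I ∅ hI (by simp), Finset.union_empty]

/-- The uniform superposition `u` has amplitude `√2 ^ (-|S|)` on the clean states, and `⟨u, u⟩ = 1`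
because the Hadamard gates are symmetric and self-inverse. -/
lemma card_cleanStates {q : ℕ} (S : Finset (Fin q)) : (cleanStates S).card = 2 ^ S.card := by
  have hn := S.nodup_toList
  have h1 := sum_mul_hadamards (n := 0) 0 (fun _ => 0) S.toList (zeroState q)
    (applyGates (n := 0) 0 (fun _ => 0) (hadamards S.toList.reverse) (zeroState q))
  have h2 := hadamards_reverse (n := 0) 0 (fun _ => 0) S.toList.reverse (zeroState q)
  rw [List.reverse_reverse] at h2
  rw [h2, hadamards_zeroState _ _ (List.nodup_reverse.mpr hn)] at h1
  have h3 : ∑ s, zeroState q s * zeroState q s = 1 := by simp [zeroState]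
  rw [h3] at h1
  simp only [uniformState, List.toFinset_reverse, Finset.toList_toFinset, mul_ite, mul_zero,
    ite_mul, zero_mul, Finset.sum_ite_mem, Finset.univ_inter, ← mul_inv, ← mul_pow, sqrt_two_mul_self] at h1
  simp only [Finset.inter_self, Finset.sum_const, nsmul_eq_mul] at h1
  have h6 : ((2 : ℂ) ^ S.card) ≠ 0 := pow_ne_zero _ two_ne_zero
  have h7 : ((cleanStates S).card : ℂ) = 2 ^ S.card := by
    field_simp at h1
    exact h1.symm
  exact_mod_cast h7

/-! ### One-hot simulation of branching programs -/

/-- The Toffoli gate, as a gate sequence that is empty if the three qubits are not distinct. -/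
def gateCCX {n q : ℕ} (a b t : Fin q) : List (Gate n q) :=
  if h : a ≠ b ∧ a ≠ t ∧ b ≠ t then [.toffoli a b t h.1 h.2.1 h.2.2] else []

/-- A QRACM lookup, as a gate sequence that is empty if its qubits are not distinct. -/
def gateLookup {n q : ℕ} (I : List (Fin q)) (k : Fin n) (t : Fin q) : List (Gate n q) :=
  if h : I.Nodup ∧ t ∉ I then [.qracm I k t h.1 h.2] else []

lemma isReversible_of_mem_gateCCX {n q : ℕ} {a b t : Fin q} {g : Gate n q}
    (hg : g ∈ gateCCX a b t) : g.IsReversible := by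
  unfold gateCCX at hg
  split_ifs at hg <;> simp_all [Gate.IsReversible]

lemma isReversible_of_mem_gateLookup {n q : ℕ} {I : List (Fin q)} {k : Fin n} {t : Fin q}
    {g : Gate n q} (hg : g ∈ gateLookup I k t) : g.IsReversible := by
  unfold gateLookup at hg
  split_ifs at hg <;> simp_all [Gate.IsReversible]

lemma gateCost_gateCCX_le {n q : ℕ} (a b t : Fin q) :
    gateCost (gateCCX a b t : List (Gate n q)) ≤ 1 := by
  unfold gateCCX
  split_ifs <;> simp [gateCost, Op.cost]

lemma gateCost_gateLookup_le {n q : ℕ} (I : List (Fin q)) (k : Fin n) (t : Fin q) :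
    gateCost (gateLookup I k t) ≤ I.length + 1 := by
  unfold gateLookup
  split_ifs <;> simp [gateCost, Op.cost]

/-- One transition of a branching program with states `S`: if the state `σ` is marked in `row`
and the bit read from the qubit `r` is `b`, mark the state `δ b σ` in `row'`. -/
noncomputable def transitionGates {n q : ℕ} {S : Type*} [Fintype S] (row row' : S → Fin q)
    (r : Fin q) (δ : Bool → S → S) : List (Gate n q) :=
  ((Finset.univ : Finset S).toList.flatMap fun σ => gateCCX r (row σ) (row' (δ true σ))) ++
    [.not r] ++
    ((Finset.univ : Finset S).toList.flatMap fun σ => gateCCX r (row σ) (row' (δ false σ))) ++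
    [.not r]

lemma gateCost_transitionGates_le {n q : ℕ} {S : Type*} [Fintype S] (row row' : S → Fin q)
    (r : Fin q) (δ : Bool → S → S) :
    gateCost (transitionGates row row' r δ : List (Gate n q)) ≤ 2 * Fintype.card S + 2 := by
  have h1 : ∀ b : Bool, gateCost ((Finset.univ : Finset S).toList.flatMap fun σ =>
      (gateCCX r (row σ) (row' (δ b σ)) : List (Gate n q))) ≤ Fintype.card S := by
    intro b
    simpa using gateCost_flatMap_le (Finset.univ : Finset S).toList
      (fun σ => (gateCCX r (row σ) (row' (δ b σ)) : List (Gate n q))) 1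
      (fun σ _ => gateCost_gateCCX_le _ _ _)
  have h2 : gateCost [(.not r : Gate n q)] = 1 := by simp [gateCost, Op.cost]
  simp only [transitionGates, gateCost_append, h2]
  have := h1 true
  have := h1 false
  omega

/-- If exactly the state `m` is marked, only the Toffoli gate controlled by `m` can fire. -/
lemma actGates_flatMap_gateCCX {n q : ℕ} (M : ℕ) (mem : ℕ → Vec n) {S : Type*} [DecidableEq S]
    (row row' : S → Fin q) (r : Fin q) (f : S → S) (m : S)
    (hr : ∀ σ, r ≠ row σ) (hr' : ∀ σ, r ≠ row' σ) (hrow : ∀ σ σ', row σ ≠ row' σ')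
    (l : List S) (hl : l.Nodup) (s : Basis q) (hs : ∀ σ, s (row σ) = decide (σ = m)) :
    actGates M mem (l.flatMap fun σ => gateCCX r (row σ) (row' (f σ))) s =
      if m ∈ l then flipBit (row' (f m)) (s r) s else s := by
  induction l generalizing s with
  | nil => rfl
  | cons σ l ih =>
    rw [List.nodup_cons] at hl
    have h1 : actGates M mem (gateCCX r (row σ) (row' (f σ))) s =
        flipBit (row' (f σ)) (s r && s (row σ)) s := by
      rw [gateCCX, dif_pos ⟨hr σ, hr' _, hrow _ _⟩]
      rfl
    rw [List.flatMap_cons, actGates_append, h1, hs]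
    by_cases h : σ = m
    · subst h
      rw [ih hl.2, if_neg hl.1]
      · simp
      · intro τ
        rw [flipBit_of_ne (hrow _ _), hs]
    · have h2 : flipBit (row' (f σ)) (s r && decide (σ = m)) s = s := by
        simp [h, flipBit]
      rw [h2, ih hl.2 s hs]
      simp [Ne.symm h]

lemma actGates_transitionGates {n q : ℕ} (M : ℕ) (mem : ℕ → Vec n) {S : Type*} [Fintype S]
    [DecidableEq S] (row row' : S → Fin q) (r : Fin q) (δ : Bool → S → S) (m : S)
    (hr : ∀ σ, r ≠ row σ) (hr' : ∀ σ, r ≠ row' σ) (hrow : ∀ σ σ', row σ ≠ row' σ')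
    (s : Basis q) (hs : ∀ σ, s (row σ) = decide (σ = m)) :
    actGates M mem (transitionGates row row' r δ) s = flipBit (row' (δ (s r) m)) true s := by
  have h1 := fun b s hs => actGates_flatMap_gateCCX M mem row row' r (δ b) m hr hr' hrow
    (Finset.univ : Finset S).toList (Finset.nodup_toList _) s hs
  simp only [Finset.mem_toList, Finset.mem_univ, if_true] at h1
  have h2 : ∀ s, actGates M mem [.not r] s = flipBit r true s := fun s => rfl
  simp only [transitionGates, actGates_append, h2]
  rw [h1 true s hs, h1 false]
  · have hne := hr' (δ true m)
    have hne' := hr' (δ false m)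
    cases h : s r
    · ext x
      by_cases hx : x = r
      · subst hx; simp [flipBit_of_ne hne, flipBit_of_ne hne']
      · rw [flipBit_of_ne hx]
        simp [flipBit, h, hne, Function.update_apply, hx, hne'.symm]
    · ext x
      by_cases hx : x = r
      · subst hx; simp [flipBit_of_ne hne, flipBit_of_ne hne']
      · rw [flipBit_of_ne hx]
        simp [flipBit, h, hne, Function.update_apply, hx, hne'.symm]
        rintro rfl
        rfl
  · intro σ
    rw [flipBit_of_ne (hr σ).symm, flipBit_of_ne (hrow _ _), hs]

/-- The circuit of an oblivious branching program `P`, a list of instructions `(r, δ)` that read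
the qubit `r` and apply the transition `δ`. The state before the instruction number `k` is kept,
in one-hot encoding, in the qubits `row k`. -/
noncomputable def programGates {n q : ℕ} {S : Type*} [Fintype S] (row : ℕ → S → Fin q) :
    List (Fin q × (Bool → S → S)) → ℕ → List (Gate n q)
  | [], _ => []
  | p :: P, k => transitionGates (row k) (row (k + 1)) p.1 p.2 ++ programGates row P (k + 1)

/-- The final state of a branching program that is started in the state `m`. -/
def runProgram {q : ℕ} {S : Type*} (P : List (Fin q × (Bool → S → S))) (s : Basis q) (m : S) : S :=
  P.foldl (fun m p => p.2 (s p.1) m) m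

lemma runProgram_congr {q : ℕ} {S : Type*} {P : List (Fin q × (Bool → S → S))} {s s' : Basis q}
    (h : ∀ p ∈ P, s p.1 = s' p.1) (m : S) : runProgram P s m = runProgram P s' m := by
  induction P generalizing m with
  | nil => rfl
  | cons p P ih =>
    simp only [runProgram, List.foldl_cons] at ih ⊢
    rw [h p List.mem_cons_self]
    exact ih (fun p' hp' => h p' (List.mem_cons_of_mem _ hp')) _

lemma gateCost_programGates_le {n q : ℕ} {S : Type*} [Fintype S] (row : ℕ → S → Fin q)
    (P : List (Fin q × (Bool → S → S))) (k : ℕ) :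
    gateCost (programGates row P k : List (Gate n q)) ≤
      P.length * (2 * Fintype.card S + 2) := by
  induction P generalizing k with
  | nil => simp [programGates, gateCost]
  | cons p P ih =>
    rw [programGates, gateCost_append, List.length_cons, add_mul, one_mul, add_comm]
    exact add_le_add (ih _) (gateCost_transitionGates_le _ _ _ _)

lemma isReversible_of_mem_programGates {n q : ℕ} {S : Type*} [Fintype S] {row : ℕ → S → Fin q}
    {P : List (Fin q × (Bool → S → S))} {k : ℕ} {g : Gate n q}
    (hg : g ∈ programGates row P k) : g.IsReversible := by
  induction P generalizing k with
  | nil => simp [programGates] at hg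
  | cons p P ih =>
    simp only [programGates, transitionGates, List.mem_append, List.mem_flatMap,
      List.mem_singleton] at hg
    rcases hg with (((⟨σ, -, h⟩ | h) | ⟨σ, -, h⟩) | h) | h
    · exact isReversible_of_mem_gateCCX h
    · subst h; trivial
    · exact isReversible_of_mem_gateCCX h
    · subst h; trivial
    · exact ih h

/-- The rows with numbers up to `R` consist of distinct qubits. -/
def RowsDistinct {q : ℕ} {S : Type*} (row : ℕ → S → Fin q) (R : ℕ) : Prop :=
  ∀ j ≤ R, ∀ k ≤ R, ∀ σ τ, row j σ = row k τ → j = k ∧ σ = τ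

/-- The circuit of a branching program marks exactly the final state in its last row, and it
changes no qubit outside the rows. -/
lemma actGates_programGates {n q : ℕ} (M : ℕ) (mem : ℕ → Vec n) {S : Type*} [Fintype S]
    [DecidableEq S] (row : ℕ → S → Fin q) (R : ℕ) (hrow : RowsDistinct row R)
    (P : List (Fin q × (Bool → S → S))) (hP : ∀ p ∈ P, ∀ j σ, p.1 ≠ row j σ)
    (k : ℕ) (hk : k + P.length ≤ R) (s : Basis q) (m : S)
    (hs : ∀ σ, s (row k σ) = decide (σ = m))
    (hs' : ∀ j σ, k < j → j ≤ R → s (row j σ) = false) :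
    (∀ σ, actGates M mem (programGates row P k) s (row (k + P.length) σ) =
        decide (σ = runProgram P s m)) ∧
      ∀ x, (∀ j σ, x ≠ row j σ) → actGates M mem (programGates row P k) s x = s x := by
  induction P generalizing k s m with
  | nil => exact ⟨hs, fun x _ => rfl⟩
  | cons p P ih =>
    rw [List.length_cons] at hk ⊢
    have hp := hP p List.mem_cons_self
    have h1 := actGates_transitionGates M mem (row k) (row (k + 1)) p.1 p.2 m (hp k) (hp (k + 1))
      (fun σ σ' h => by have := hrow k (by omega) (k + 1) (by omega) σ σ' h; omega) s hs
    rw [programGates, actGates_append, h1]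
    set s1 := flipBit (row (k + 1) (p.2 (s p.1) m)) true s with hs1
    have hout : ∀ x, (∀ j σ, x ≠ row j σ) → s1 x = s x := fun x hx => flipBit_of_ne (hx _ _) _ _
    have h2 := ih (fun p' hp' => hP p' (List.mem_cons_of_mem _ hp')) (k + 1) (by omega) s1
      (p.2 (s p.1) m) ?_ ?_
    · rw [show k + (P.length + 1) = k + 1 + P.length by ring]
      refine ⟨fun σ => ?_, fun x hx => (h2.2 x hx).trans (hout x hx)⟩
      rw [h2.1 σ, runProgram_congr (s' := s)
        (fun p' hp' => hout _ (hP p' (List.mem_cons_of_mem _ hp')))]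
      rfl
    · intro σ
      by_cases h : σ = p.2 (s p.1) m
      · rw [← h] at hs1
        rw [hs1, flipBit_self, hs' _ _ (by omega) (by omega)]
        simp [h]
      · rw [hs1, flipBit_of_ne, hs' _ _ (by omega) (by omega)]
        · simp [h]
        · intro h'
          exact h (hrow _ (by omega) _ (by omega) _ _ h').2
    · intro j σ hj hjR
      rw [hs1, flipBit_of_ne, hs' j σ (by omega) hjR]
      intro h'
      have := hrow _ hjR _ (by omega) _ _ h'
      omega

/-! ### The layout of the qubits -/

/-- The states of the branching program that tests a pair `(i, j)`: the comparison of `i` and `j`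
so far, the last bit read of `i`, the comparison of `j` and `B` so far, and a weight counter. -/
abbrev TestState (n : ℕ) : Type := Bool × Bool × Bool × ZMod (n + 1)

/-- The names of the qubits: two address registers of `l` qubits each, a register for an `n`-bit
word, and the rows of a branching program of length at most `2 * l + n`. -/
abbrev Wire (l n : ℕ) : Type :=
  (Fin l ⊕ Fin l) ⊕ (Fin n ⊕ (Fin (2 * l + n + 1) × TestState n))

/-- The number of qubits. -/
def numQubits (l n : ℕ) : ℕ := Fintype.card (Wire l n)

lemma numQubits_eq (l n : ℕ) :
    numQubits l n = 2 * l + (n + (2 * l + n + 1) * (8 * (n + 1))) := by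
  simp only [numQubits, Fintype.card_sum, Fintype.card_prod, Fintype.card_fin, Fintype.card_bool,
    ZMod.card]
  ring

/-- The numbering of the qubits. -/
noncomputable def wire {l n : ℕ} : Wire l n ≃ Fin (numQubits l n) := Fintype.equivFin _

/-- The qubits of the left address. -/
noncomputable def leftBit {l : ℕ} (n : ℕ) (k : Fin l) : Fin (numQubits l n) := wire (.inl (.inl k))

/-- The qubits of the right address. -/
noncomputable def rightBit {l : ℕ} (n : ℕ) (k : Fin l) : Fin (numQubits l n) :=
  wire (.inl (.inr k))

/-- The qubits of the word register. -/
noncomputable def wordBit (l : ℕ) {n : ℕ} (k : Fin n) : Fin (numQubits l n) :=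
  wire (.inr (.inl k))

/-- The rows of the branching programs; row numbers are read modulo the number of rows. -/
noncomputable def rowBit (l n k : ℕ) (σ : TestState n) : Fin (numQubits l n) :=
  wire (.inr (.inr (Fin.ofNat _ k, σ)))

/-- The left address register. -/
noncomputable def leftReg (l n : ℕ) : List (Fin (numQubits l n)) :=
  (List.finRange l).map (leftBit n)

/-- The right address register. -/
noncomputable def rightReg (l n : ℕ) : List (Fin (numQubits l n)) :=
  (List.finRange l).map (rightBit n)

lemma rowsDistinct_rowBit (l n : ℕ) : RowsDistinct (rowBit l n) (2 * l + n) := by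
  intro j hj k hk σ τ h
  simp only [rowBit, EmbeddingLike.apply_eq_iff_eq, Sum.inr.injEq, Prod.mk.injEq] at h
  refine ⟨?_, h.2⟩
  have := congrArg Fin.val h.1
  simpa [Fin.ofNat, Nat.mod_eq_of_lt (Nat.lt_succ_of_le hj),
    Nat.mod_eq_of_lt (Nat.lt_succ_of_le hk)] using this

lemma mem_leftReg {l n : ℕ} {x : Fin (numQubits l n)} :
    x ∈ leftReg l n ↔ ∃ k, leftBit n k = x := by
  simp [leftReg]

lemma mem_rightReg {l n : ℕ} {x : Fin (numQubits l n)} :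
    x ∈ rightReg l n ↔ ∃ k, rightBit n k = x := by
  simp [rightReg]

lemma nodup_leftReg (l n : ℕ) : (leftReg l n).Nodup :=
  (List.nodup_finRange l).map fun a b h => by simpa [leftBit] using h

lemma nodup_rightReg (l n : ℕ) : (rightReg l n).Nodup :=
  (List.nodup_finRange l).map fun a b h => by simpa [rightBit] using h

lemma length_leftReg (l n : ℕ) : (leftReg l n).length = l := by simp [leftReg]

lemma length_rightReg (l n : ℕ) : (rightReg l n).length = l := by simp [rightReg]

/-- Both address registers. -/
noncomputable def addrReg (l n : ℕ) : List (Fin (numQubits l n)) := leftReg l n ++ rightReg l n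

lemma nodup_addrReg (l n : ℕ) : (addrReg l n).Nodup := by
  refine (nodup_leftReg l n).append (nodup_rightReg l n) ?_
  intro x hx hy
  obtain ⟨a, rfl⟩ := mem_leftReg.mp hx
  obtain ⟨b, hb⟩ := mem_rightReg.mp hy
  simp [leftBit, rightBit] at hb

lemma length_addrReg (l n : ℕ) : (addrReg l n).length = 2 * l := by
  simp [addrReg, length_leftReg, length_rightReg, two_mul]

lemma wordBit_notMem_addrReg (l : ℕ) {n : ℕ} (k : Fin n) : wordBit l k ∉ addrReg l n := by
  simp [addrReg, mem_leftReg, mem_rightReg, leftBit, rightBit, wordBit]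

lemma rowBit_notMem_addrReg (l n k : ℕ) (σ : TestState n) : rowBit l n k σ ∉ addrReg l n := by
  simp [addrReg, mem_leftReg, mem_rightReg, leftBit, rightBit, rowBit]

lemma wordBit_ne_rowBit {l n : ℕ} (k : Fin n) (j : ℕ) (σ : TestState n) :
    wordBit l k ≠ rowBit l n j σ := by
  simp [wordBit, rowBit]

/-! ### Loading the sum of two words -/

/-- XOR the words at the two addresses into the word register. -/
noncomputable def loadGates (l n : ℕ) (ks : List (Fin n)) : List (Gate n (numQubits l n)) :=
  ks.flatMap fun k => gateLookup (leftReg l n) k (wordBit l k) ++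
    gateLookup (rightReg l n) k (wordBit l k)

lemma gateCost_loadGates_le (l n : ℕ) (ks : List (Fin n)) :
    gateCost (loadGates l n ks) ≤ ks.length * (2 * l + 2) := by
  refine gateCost_flatMap_le _ _ _ fun k _ => ?_
  rw [gateCost_append]
  have h1 := gateCost_gateLookup_le (leftReg l n) k (wordBit l k)
  have h2 := gateCost_gateLookup_le (rightReg l n) k (wordBit l k)
  rw [length_leftReg] at h1
  rw [length_rightReg] at h2
  omega

/-- The bit `k` of the word at the address held by the register `I`, as QRACM returns it. -/
def lookupBit {n q : ℕ} (M : ℕ) (mem : ℕ → Vec n) (I : List (Fin q)) (k : Fin n) (s : Basis q) :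
    Bool :=
  decide (regVal I s < M ∧ mem (regVal I s) k = 1)

lemma actGates_loadGates {l n : ℕ} (M : ℕ) (mem : ℕ → Vec n) (ks : List (Fin n)) (hks : ks.Nodup)
    (s : Basis (numQubits l n)) :
    (∀ x, (∀ k, x ≠ wordBit l k) → actGates M mem (loadGates l n ks) s x = s x) ∧
    ∀ k, actGates M mem (loadGates l n ks) s (wordBit l k) =
      if k ∈ ks then xor (xor (s (wordBit l k)) (lookupBit M mem (leftReg l n) k s))
        (lookupBit M mem (rightReg l n) k s) else s (wordBit l k) := by
  induction ks generalizing s with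
  | nil => exact ⟨fun x _ => rfl, fun k => rfl⟩
  | cons k ks ih =>
    rw [List.nodup_cons] at hks
    have hL : ∀ j : Fin n, wordBit l j ∉ leftReg l n := fun j h =>
      wordBit_notMem_addrReg l j (List.mem_append_left _ h)
    have hR : ∀ j : Fin n, wordBit l j ∉ rightReg l n := fun j h =>
      wordBit_notMem_addrReg l j (List.mem_append_right _ h)
    set bL := lookupBit M mem (leftReg l n) k s with hbL
    set bR := lookupBit M mem (rightReg l n) k s with hbR
    have e1 : ∀ s, actGates M mem (gateLookup (leftReg l n) k (wordBit l k)) s =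
        flipBit (wordBit l k) (lookupBit M mem (leftReg l n) k s) s := by
      intro s
      rw [gateLookup, dif_pos ⟨nodup_leftReg l n, hL k⟩]
      rfl
    have e2 : ∀ s, actGates M mem (gateLookup (rightReg l n) k (wordBit l k)) s =
        flipBit (wordBit l k) (lookupBit M mem (rightReg l n) k s) s := by
      intro s
      rw [gateLookup, dif_pos ⟨nodup_rightReg l n, hR k⟩]
      rfl
    have fL : ∀ j b s, lookupBit M mem (leftReg l n) j (flipBit (wordBit l k) b s) =
        lookupBit M mem (leftReg l n) j s := by
      intro j b s
      rw [lookupBit, regVal_congr (s' := s) fun x hx => flipBit_of_ne ?_ _ _]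
      · rfl
      · rintro rfl; exact hL _ hx
    have fR : ∀ j b s, lookupBit M mem (rightReg l n) j (flipBit (wordBit l k) b s) =
        lookupBit M mem (rightReg l n) j s := by
      intro j b s
      rw [lookupBit, regVal_congr (s' := s) fun x hx => flipBit_of_ne ?_ _ _]
      · rfl
      · rintro rfl; exact hR _ hx
    have e3 : actGates M mem (loadGates l n (k :: ks)) s = actGates M mem (loadGates l n ks)
        (flipBit (wordBit l k) bR (flipBit (wordBit l k) bL s)) := by
      rw [loadGates, List.flatMap_cons, actGates_append, actGates_append, e1, e2, fR]
      rfl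
    rw [e3]
    obtain ⟨i1, i2⟩ := ih hks.2 (flipBit (wordBit l k) bR (flipBit (wordBit l k) bL s))
    constructor
    · intro x hx
      rw [i1 x hx, flipBit_of_ne (hx k), flipBit_of_ne (hx k)]
    · intro j
      rw [i2 j, fL, fL, fR, fR]
      by_cases hjk : j = k
      · subst hjk
        simp [hks.1, hbL, hbR]
      · have : wordBit l j ≠ wordBit l k := by simpa [wordBit] using hjk
        rw [flipBit_of_ne this, flipBit_of_ne this]
        simp [hjk]

/-! ### The circuit that recognizes solution pairs -/

/-- Read a bit of the left address. -/
def readLeft {n : ℕ} (b : Bool) (σ : TestState n) : TestState n :=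
  (σ.1, b, σ.2.2.1, σ.2.2.2)

/-- Read the bit `b` of the right address, where `β` is the corresponding bit of `B`. As the bits
are read from the least significant one on, the last bits in which two numbers differ decide their
comparison. -/
def readRight {n : ℕ} (β b : Bool) (σ : TestState n) : TestState n :=
  (if σ.2.1 = b then σ.1 else b, false, if b = β then σ.2.2.1 else β, σ.2.2.2)

/-- Read a bit of the word. -/
def readWord {n : ℕ} (b : Bool) (σ : TestState n) : TestState n :=
  (σ.1, σ.2.1, σ.2.2.1, σ.2.2.2 + if b then 1 else 0)

/-- The part of the branching program that compares the addresses. -/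
noncomputable def compareProgram (l n B : ℕ) (ks : List (Fin l)) :
    List (Fin (numQubits l n) × (Bool → TestState n → TestState n)) :=
  ks.flatMap fun k => [(leftBit n k, readLeft), (rightBit n k, readRight (B.testBit k))]

/-- The part of the branching program that counts the ones of the word. -/
noncomputable def countProgram (l n : ℕ) (ks : List (Fin n)) :
    List (Fin (numQubits l n) × (Bool → TestState n → TestState n)) :=
  ks.map fun k => (wordBit l k, readWord)

/-- The start state of the branching programs. -/
def startState (n : ℕ) : TestState n := (false, false, false, 0)

/-- The circuit that tests whether the addresses `(i, j)` form a solution pair. -/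
noncomputable def testGates (l n B : ℕ) : List (Gate n (numQubits l n)) :=
  loadGates l n (List.finRange n) ++ ([.not (rowBit l n 0 (startState n))] ++
    programGates (rowBit l n)
      (compareProgram l n B (List.finRange l) ++ countProgram l n (List.finRange n)) 0)

/-- The qubit that holds the result of the test. -/
noncomputable def testFlag (l n w : ℕ) : Fin (numQubits l n) :=
  rowBit l n (2 * l + n) (true, false, true, (w : ZMod (n + 1)))

lemma runProgram_append {q : ℕ} {S : Type*} (P Q : List (Fin q × (Bool → S → S))) (s : Basis q)
    (m : S) : runProgram (P ++ Q) s m = runProgram Q s (runProgram P s m) := by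
  simp [runProgram]

lemma regVal_cons {q : ℕ} (x : Fin q) (I : List (Fin q)) (s : Basis q) :
    regVal (x :: I) s = (s x).toNat + 2 * regVal I s := by
  simp [regVal, Nat.ofDigits_cons]

lemma runProgram_compareProgram (l n B : ℕ) (ks : List (Fin l)) (s : Basis (numQubits l n))
    (c d : Bool) (m : ZMod (n + 1)) :
    runProgram (compareProgram l n B ks) s (c, false, d, m) =
      (decide (regVal (ks.map (leftBit n)) s < regVal (ks.map (rightBit n)) s ∨
          regVal (ks.map (leftBit n)) s = regVal (ks.map (rightBit n)) s ∧ c = true), false,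
        decide (regVal (ks.map (rightBit n)) s <
            Nat.ofDigits 2 (ks.map fun k : Fin l => (B.testBit k).toNat) ∨
          regVal (ks.map (rightBit n)) s =
            Nat.ofDigits 2 (ks.map fun k : Fin l => (B.testBit k).toNat) ∧ d = true), m) := by
  induction ks generalizing c d with
  | nil => simp [compareProgram, runProgram, regVal]
  | cons k ks ih =>
    have h1 : runProgram (compareProgram l n B (k :: ks)) s (c, false, d, m) =
        runProgram (compareProgram l n B ks) s
          (if s (leftBit n k) = s (rightBit n k) then c else s (rightBit n k), false,
            if s (rightBit n k) = B.testBit k then d else B.testBit k, m) := rfl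
    rw [h1, ih]
    refine Prod.ext (decide_eq_decide.mpr ?_) (Prod.ext rfl (Prod.ext (decide_eq_decide.mpr ?_) rfl))
    · rw [List.map_cons, List.map_cons, regVal_cons, regVal_cons]
      generalize regVal (ks.map (leftBit n)) s = a
      generalize regVal (ks.map (rightBit n)) s = b
      cases s (leftBit n k) <;> cases s (rightBit n k) <;> simp <;> omega
    · rw [List.map_cons, List.map_cons, regVal_cons, Nat.ofDigits_cons]
      generalize regVal (ks.map (rightBit n)) s = b
      generalize Nat.ofDigits 2 (ks.map fun k : Fin l => (B.testBit k).toNat) = e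
      cases s (rightBit n k) <;> cases B.testBit k <;> simp <;> omega

lemma runProgram_countProgram (l n : ℕ) (ks : List (Fin n)) (s : Basis (numQubits l n))
    (σ : TestState n) :
    runProgram (countProgram l n ks) s σ = (σ.1, σ.2.1, σ.2.2.1,
      σ.2.2.2 + (ks.map fun k => if s (wordBit l k) then (1 : ZMod (n + 1)) else 0).sum) := by
  induction ks generalizing σ with
  | nil => simp [countProgram, runProgram]
  | cons k ks ih =>
    have h1 : runProgram (countProgram l n (k :: ks)) s σ =
        runProgram (countProgram l n ks) s (readWord (s (wordBit l k)) σ) := rfl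
    rw [h1, ih]
    simp [readWord, add_assoc]

lemma ofDigits_testBit (l B : ℕ) (h : B < 2 ^ l) :
    Nat.ofDigits 2 ((List.finRange l).map fun k : Fin l => (B.testBit k).toNat) = B := by
  induction l generalizing B with
  | zero => simp at h; simp [h]
  | succ l ih =>
    rw [List.finRange_succ, List.map_cons, List.map_map, Nat.ofDigits_cons]
    have h1 := ih (B / 2) (by rw [pow_succ] at h; omega)
    have h2 : ((fun k : Fin (l + 1) => (B.testBit k).toNat) ∘ Fin.succ) =
        fun k : Fin l => ((B / 2).testBit k).toNat := by
      ext k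
      simp [Nat.testBit_succ]
    rw [h2, h1]
    have h3 : (B.testBit ((0 : Fin (l + 1)) : ℕ)).toNat = B % 2 := by
      simp [Nat.testBit_zero]
      rcases Nat.mod_two_eq_zero_or_one B with h | h <;> simp [h]
    rw [h3]
    omega

lemma runProgram_test {l n B : ℕ} (hB : B < 2 ^ l) (s : Basis (numQubits l n)) :
    runProgram (compareProgram l n B (List.finRange l) ++ countProgram l n (List.finRange n)) s
        (startState n) =
      (decide (regVal (leftReg l n) s < regVal (rightReg l n) s), false,
        decide (regVal (rightReg l n) s < B),
        ∑ k, if s (wordBit l k) then (1 : ZMod (n + 1)) else 0) := by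
  rw [runProgram_append, startState, runProgram_compareProgram, runProgram_countProgram,
    ofDigits_testBit l B hB]
  refine Prod.ext (decide_eq_decide.mpr ?_) (Prod.ext rfl (Prod.ext (decide_eq_decide.mpr ?_) ?_))
  · simp [leftReg, rightReg]
  · simp [rightReg]
  · rw [Fin.sum_univ_def]
    exact zero_add _

lemma length_compareProgram (l n B : ℕ) :
    (compareProgram l n B (List.finRange l)).length = 2 * l := by
  simp [compareProgram, List.length_flatMap, mul_comm]

lemma length_countProgram (l n : ℕ) : (countProgram l n (List.finRange n)).length = n := by
  simp [countProgram]

lemma isReversible_of_mem_testGates {l n B : ℕ} {g : Gate n (numQubits l n)}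
    (hg : g ∈ testGates l n B) : g.IsReversible := by
  simp only [testGates, loadGates, List.mem_append, List.mem_flatMap, List.mem_singleton] at hg
  rcases hg with ⟨k, -, h | h⟩ | h | h
  · exact isReversible_of_mem_gateLookup h
  · exact isReversible_of_mem_gateLookup h
  · subst h; trivial
  · exact isReversible_of_mem_programGates h

/-- A branching program run on clean rows, with the start state marked first. -/
lemma actGates_programGates_clean {l n : ℕ} (M : ℕ) (mem : ℕ → Vec n)
    (P : List (Fin (numQubits l n) × (Bool → TestState n → TestState n)))
    (hP : ∀ p ∈ P, ∀ j σ, p.1 ≠ rowBit l n j σ) (hlen : P.length ≤ 2 * l + n)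
    (s : Basis (numQubits l n)) (hs : ∀ j σ, s (rowBit l n j σ) = false) :
    (∀ σ, actGates M mem ([.not (rowBit l n 0 (startState n))] ++ programGates (rowBit l n) P 0) s
        (rowBit l n P.length σ) = decide (σ = runProgram P s (startState n))) ∧
      ∀ x, (∀ j σ, x ≠ rowBit l n j σ) → actGates M mem
        ([.not (rowBit l n 0 (startState n))] ++ programGates (rowBit l n) P 0) s x = s x := by
  have h0 : actGates M mem [(.not (rowBit l n 0 (startState n)) : Gate n (numQubits l n))] s =
      flipBit (rowBit l n 0 (startState n)) true s := rfl
  rw [actGates_append, h0]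
  set s1 := flipBit (rowBit l n 0 (startState n)) true s with hs1
  have hout : ∀ x, (∀ j σ, x ≠ rowBit l n j σ) → s1 x = s x :=
    fun x hx => flipBit_of_ne (hx _ _) _ _
  have h12 := actGates_programGates M mem (rowBit l n) (2 * l + n)
    (rowsDistinct_rowBit l n) P hP 0 (by omega) s1 (startState n) ?_ ?_
  · obtain ⟨h1, h2⟩ := h12
    rw [zero_add] at h1
    refine ⟨fun σ => ?_, fun x hx => (h2 x hx).trans (hout x hx)⟩
    rw [h1, runProgram_congr fun p hp => hout _ (hP p hp)]
  · intro σ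
    by_cases h : σ = startState n
    · rw [hs1, h, flipBit_self, hs]; simp
    · rw [hs1, flipBit_of_ne, hs]
      · simp [h]
      · intro h'
        exact h (rowsDistinct_rowBit l n _ (by omega) _ (by omega) _ _ h').2
  · intro j σ hj hjR
    rw [hs1, flipBit_of_ne, hs]
    intro h'
    have := (rowsDistinct_rowBit l n _ hjR _ (by omega) _ _ h').1
    omega

lemma sum_count_eq_hammingNorm {n : ℕ} (x y : Vec n) :
    (∑ k, if xor (decide (x k = 1)) (decide (y k = 1)) then (1 : ZMod (n + 1)) else 0) =
      (hammingNorm (x + y) : ZMod (n + 1)) := by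
  rw [Finset.sum_boole, hammingNorm]
  congr 2
  ext k
  simp only [Finset.mem_filter, Finset.mem_univ, true_and, Pi.add_apply]
  generalize x k = a
  generalize y k = b
  revert a b
  decide

/-- The test circuit recognizes the solution pairs `(i, j)` and leaves the addresses unchanged. -/
lemma actGates_testGates {l n B w : ℕ} (mem : ℕ → Vec n) (hB : B < 2 ^ l) (hw : w ≤ n)
    {s : Basis (numQubits l n)} (hs : s ∈ cleanStates (addrReg l n).toFinset) :
    (actGates B mem (testGates l n B) s (testFlag l n w) =
      decide (regVal (leftReg l n) s < regVal (rightReg l n) s ∧ regVal (rightReg l n) s < B ∧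
        hammingNorm (mem (regVal (leftReg l n) s) + mem (regVal (rightReg l n) s)) = w)) ∧
    ∀ x ∈ addrReg l n, actGates B mem (testGates l n B) s x = s x := by
  rw [mem_cleanStates] at hs
  simp only [List.mem_toFinset] at hs
  obtain ⟨hl1, hl2⟩ := actGates_loadGates B mem (List.finRange n) (List.nodup_finRange n) s
  rw [testGates, actGates_append]
  set s1 := actGates B mem (loadGates l n (List.finRange n)) s with hs1
  set P := compareProgram l n B (List.finRange l) ++ countProgram l n (List.finRange n) with hPdef
  have hPlen : P.length = 2 * l + n := by
    rw [hPdef, List.length_append, length_compareProgram, length_countProgram]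
  have hp12 := actGates_programGates_clean B mem P ?_ hPlen.le s1 ?_
  · obtain ⟨hp1, hp2⟩ := hp12
    rw [hPlen] at hp1
    have haddr : ∀ x ∈ addrReg l n, s1 x = s x := by
      intro x hx
      apply hl1
      rintro k rfl
      exact wordBit_notMem_addrReg l k hx
    constructor
    · rw [testFlag, hp1, hPdef, runProgram_test hB,
        regVal_congr fun x hx => haddr x (List.mem_append_left _ hx),
        regVal_congr (I := rightReg l n) fun x hx => haddr x (List.mem_append_right _ hx),
        decide_eq_decide]
      set i := regVal (leftReg l n) s with hi
      set j := regVal (rightReg l n) s with hj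
      simp only [Prod.mk.injEq, true_and, eq_comm (a := true), decide_eq_true_eq]
      refine and_congr_right fun hij => and_congr_right fun hjB => ?_
      have hbit : ∀ k : Fin n, s1 (wordBit l k) =
          xor (decide (mem i k = 1)) (decide (mem j k = 1)) := by
        intro k
        rw [hl2 k, if_pos (List.mem_finRange k), hs _ (wordBit_notMem_addrReg l k)]
        simp only [lookupBit, ← hi, ← hj, hjB, hij.trans hjB, true_and, Bool.false_xor]
      simp only [hbit]
      rw [sum_count_eq_hammingNorm, ZMod.natCast_eq_natCast_iff', eq_comm,
        Nat.mod_eq_of_lt (Nat.lt_succ_of_le hw), Nat.mod_eq_of_lt]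
      calc hammingNorm (mem i + mem j) ≤ Fintype.card (Fin n) := hammingNorm_le_card_fintype
        _ < n + 1 := by simp
    · intro x hx
      rw [hp2 x, haddr x hx]
      rintro j σ rfl
      exact rowBit_notMem_addrReg l n j σ hx
  · intro p hp j σ
    rw [hPdef, List.mem_append] at hp
    rcases hp with hp | hp
    · simp only [compareProgram, List.mem_flatMap, List.mem_cons, List.not_mem_nil, or_false] at hp
      obtain ⟨k, -, rfl | rfl⟩ := hp <;> simp [leftBit, rightBit, rowBit]
    · simp only [countProgram, List.mem_map] at hp
      obtain ⟨k, -, rfl⟩ := hp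
      exact wordBit_ne_rowBit _ _ _
  · intro j σ
    rw [hl1, hs _ (rowBit_notMem_addrReg l n j σ)]
    intro k h
    exact wordBit_ne_rowBit k j σ h.symm

/-! ### The circuit that recognizes the zero address -/

/-- The branching program that leaves its start state if one of the address bits is `1`. -/
noncomputable def zeroProgram (l n : ℕ) :
    List (Fin (numQubits l n) × (Bool → TestState n → TestState n)) :=
  (addrReg l n).map fun x => (x, fun b σ => if b then (true, false, false, 0) else σ)

/-- The circuit that tests whether all address qubits are `0`. -/
noncomputable def zeroGates (l n : ℕ) : List (Gate n (numQubits l n)) :=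
  [.not (rowBit l n 0 (startState n))] ++ programGates (rowBit l n) (zeroProgram l n) 0

lemma isReversible_of_mem_zeroGates {l n : ℕ} {g : Gate n (numQubits l n)}
    (hg : g ∈ zeroGates l n) : g.IsReversible := by
  simp only [zeroGates, List.mem_append, List.mem_singleton] at hg
  rcases hg with h | h
  · subst h; trivial
  · exact isReversible_of_mem_programGates h

/-- A program that moves from `m` to the absorbing state `d` on reading a `1` stays in `m` if and
only if it reads only zeros. -/
lemma runProgram_zero {q : ℕ} {S : Type*} (I : List (Fin q)) (s : Basis q) {m d : S}
    (hd : d ≠ m) (a : S) (ha : a = m ∨ a = d) :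
    m = runProgram (I.map fun x => (x, fun b σ => if b then d else σ)) s a ↔
      a = m ∧ ∀ x ∈ I, s x = false := by
  induction I generalizing a with
  | nil => exact ⟨fun h => ⟨h.symm, by simp⟩, fun h => h.1.symm⟩
  | cons x I ih =>
    have h1 : runProgram ((x :: I).map fun x => (x, fun b σ => if b then d else σ)) s a =
        runProgram (I.map fun x => (x, fun b σ => if b then d else σ)) s
          (if s x then d else a) := rfl
    rw [h1, ih _ (by split_ifs <;> simp [ha])]
    cases h : s x <;> simp [h, hd]

lemma actGates_zeroGates {l n : ℕ} (M : ℕ) (mem : ℕ → Vec n)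
    {s : Basis (numQubits l n)} (hs : s ∈ cleanStates (addrReg l n).toFinset) :
    actGates M mem (zeroGates l n) s (rowBit l n (2 * l) (startState n)) =
      decide (s = fun _ => false) := by
  rw [mem_cleanStates] at hs
  simp only [List.mem_toFinset] at hs
  have hlen : (zeroProgram l n).length = 2 * l := by simp [zeroProgram, length_addrReg]
  have h := (actGates_programGates_clean M mem (zeroProgram l n) ?_ (by omega) s
    fun j σ => hs _ (rowBit_notMem_addrReg l n j σ)).1 (startState n)
  · rw [hlen] at h
    rw [zeroGates, h, decide_eq_decide, zeroProgram,
      runProgram_zero _ _ (by simp [startState]) _ (.inl rfl)]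
    constructor
    · rintro ⟨-, h⟩
      ext x
      by_cases hx : x ∈ addrReg l n
      · exact h x hx
      · exact hs x hx
    · rintro rfl
      exact ⟨rfl, fun _ _ => rfl⟩
  · intro p hp j σ
    simp only [zeroProgram, List.mem_map] at hp
    obtain ⟨x, hx, rfl⟩ := hp
    rintro rfl
    exact rowBit_notMem_addrReg l n j σ hx

/-! ### The size of the circuits -/

lemma gateCost_testGates_le (l n B : ℕ) :
    gateCost (testGates l n B) ≤ 20 * (2 * l + n + 1) ^ 2 := by
  have h1 := gateCost_loadGates_le l n (List.finRange n)
  have h2 := gateCost_programGates_le (n := n) (rowBit l n)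
    (compareProgram l n B (List.finRange l) ++ countProgram l n (List.finRange n)) 0
  have h3 : gateCost [(.not (rowBit l n 0 (startState n)) : Gate n (numQubits l n))] = 1 := by
    simp [gateCost, Op.cost]
  rw [List.length_append, length_compareProgram, length_countProgram] at h2
  have h4 : Fintype.card (TestState n) = 8 * (n + 1) := by
    simp only [Fintype.card_prod, Fintype.card_bool, ZMod.card]; ring
  rw [h4] at h2
  rw [List.length_finRange] at h1
  rw [testGates, gateCost_append, gateCost_append, h3]
  nlinarith [Nat.zero_le l, Nat.zero_le n, Nat.zero_le (l * n), Nat.zero_le (l * l)]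

lemma gateCost_zeroGates_le (l n : ℕ) :
    gateCost (zeroGates l n) ≤ 20 * (2 * l + n + 1) ^ 2 := by
  have h2 := gateCost_programGates_le (n := n) (rowBit l n) (zeroProgram l n) 0
  have h3 : gateCost [(.not (rowBit l n 0 (startState n)) : Gate n (numQubits l n))] = 1 := by
    simp [gateCost, Op.cost]
  have hlen : (zeroProgram l n).length = 2 * l := by simp [zeroProgram, length_addrReg]
  have h4 : Fintype.card (TestState n) = 8 * (n + 1) := by
    simp only [Fintype.card_prod, Fintype.card_bool, ZMod.card]; ring
  rw [hlen, h4] at h2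
  rw [zeroGates, gateCost_append, h3]
  nlinarith [Nat.zero_le l, Nat.zero_le n, Nat.zero_le (l * n), Nat.zero_le (l * l)]

/-! ### Grover iterations -/

/-- A state with amplitude `a` on `G`, `b` on the rest of `U`, and `0` outside `U`. -/
noncomputable def twoLevel {q : ℕ} (U G : Finset (Basis q)) (a b : ℝ) : State q :=
  fun s => if s ∈ U then (if s ∈ G then (a : ℂ) else (b : ℂ)) else 0

lemma had_eq_zero_of_notMem {n q : ℕ} (M : ℕ) (mem : ℕ → Vec n) {S : Finset (Fin q)} {i : Fin q}
    (hi : i ∈ S) {ψ : State q} (hψ : ∀ s ∉ cleanStates S, ψ s = 0) :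
    ∀ s ∉ cleanStates S, (Gate.had i : Gate n q).apply M mem ψ s = 0 := by
  intro s hs
  have : flipBit i true s ∉ cleanStates S := by
    intro h
    apply hs
    rw [mem_cleanStates] at h ⊢
    intro x hx
    rw [← h x hx, flipBit_of_ne]
    rintro rfl
    exact hx hi
  rw [had_apply, hψ s hs, hψ _ this]
  simp

lemma hadamards_eq_zero_of_notMem {n q : ℕ} (M : ℕ) (mem : ℕ → Vec n) {S : Finset (Fin q)}
    (I : List (Fin q)) (hI : ∀ i ∈ I, i ∈ S) {ψ : State q} (hψ : ∀ s ∉ cleanStates S, ψ s = 0) :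
    ∀ s ∉ cleanStates S, applyGates M mem (hadamards I) ψ s = 0 := by
  induction I generalizing ψ with
  | nil => exact hψ
  | cons i I ih =>
    exact ih (fun j hj => hI j (List.mem_cons_of_mem _ hj))
      (had_eq_zero_of_notMem M mem (hI i List.mem_cons_self) hψ)

/-- The reflection about the uniform superposition of the addresses, up to the sign. -/
noncomputable def diffusionGates (l n : ℕ) : List (Gate n (numQubits l n)) :=
  hadamards (addrReg l n).reverse ++
    (phaseOracle (zeroGates l n) (rowBit l n (2 * l) (startState n)) ++ hadamards (addrReg l n))

/-- One Grover iteration. -/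
noncomputable def groverGates (l n B w : ℕ) : List (Gate n (numQubits l n)) :=
  phaseOracle (testGates l n B) (testFlag l n w) ++ diffusionGates l n

/-- The basis states with clean ancillas. -/
noncomputable def addrStates (l n : ℕ) : Finset (Basis (numQubits l n)) :=
  cleanStates (addrReg l n).toFinset

/-- The basis states with clean ancillas whose addresses form a solution pair. -/
noncomputable def goodStates (l n B w : ℕ) (mem : ℕ → Vec n) : Finset (Basis (numQubits l n)) :=
  (addrStates l n).filter fun s =>
    regVal (leftReg l n) s < regVal (rightReg l n) s ∧ regVal (rightReg l n) s < B ∧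
      hammingNorm (mem (regVal (leftReg l n) s) + mem (regVal (rightReg l n) s)) = w

lemma card_addrStates (l n : ℕ) : (addrStates l n).card = 2 ^ (2 * l) := by
  rw [addrStates, card_cleanStates, List.toFinset_card_of_nodup (nodup_addrReg l n),
    length_addrReg]

lemma uniformState_addrReg (l n : ℕ) (s : Basis (numQubits l n)) :
    uniformState (addrReg l n).toFinset s =
      if s ∈ addrStates l n then ((Real.sqrt 2 : ℂ) ^ (2 * l))⁻¹ else 0 := by
  rw [uniformState, List.toFinset_card_of_nodup (nodup_addrReg l n), length_addrReg]
  rfl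

/-- The diffusion circuit maps `ψ` to `ψ - 2 ⟨u, ψ⟩ u` with the uniform superposition `u`. -/
lemma applyGates_diffusionGates {l n : ℕ} (M : ℕ) (mem : ℕ → Vec n)
    {ψ : State (numQubits l n)} (hψ : ∀ s ∉ addrStates l n, ψ s = 0)
    (s : Basis (numQubits l n)) (hs : s ∈ addrStates l n) :
    applyGates M mem (diffusionGates l n) ψ s = ψ s - 2 * ((∑ t, ψ t) / 2 ^ (2 * l)) := by
  set φ := applyGates M mem (hadamards (addrReg l n).reverse) ψ with hφ
  have hφ0 : ∀ s ∉ addrStates l n, φ s = 0 :=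
    hadamards_eq_zero_of_notMem M mem _ (by simp) hψ
  have h1 : applyGates M mem
      (phaseOracle (zeroGates l n) (rowBit l n (2 * l) (startState n))) φ =
      fun s => φ s - (2 * φ fun _ => false) * zeroState _ s := by
    ext s
    rw [applyGates_phaseOracle M mem fun g hg => isReversible_of_mem_zeroGates hg]
    by_cases hs : s ∈ addrStates l n
    · rw [actGates_zeroGates M mem hs]
      by_cases h : s = fun _ => false
      · subst h; simp [zeroState]; ring
      · simp [zeroState, h]
    · have h : s ≠ fun _ => false := by
        rintro rfl
        exact hs (by simp [addrStates, mem_cleanStates])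
      simp [hφ0 s hs, zeroState, h]
  have h2 : φ (fun _ => false) = (((Real.sqrt 2 : ℂ) ^ (2 * l))⁻¹) * ∑ t, ψ t := by
    have h3 := sum_mul_hadamards M mem (addrReg l n).reverse (zeroState _) ψ
    rw [List.reverse_reverse, hadamards_zeroState M mem (nodup_addrReg l n)] at h3
    have h4 : ∑ s, zeroState (numQubits l n) s * φ s = φ fun _ => false := by
      simp [zeroState]
    rw [← h4, h3, Finset.mul_sum]
    refine Finset.sum_congr rfl fun t _ => ?_
    by_cases ht : t ∈ addrStates l n
    · rw [uniformState_addrReg, if_pos ht]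
    · rw [hψ t ht]; simp
  have h5 : applyGates M mem (hadamards (addrReg l n)) φ = ψ := by
    have := hadamards_reverse M mem (addrReg l n).reverse ψ
    rwa [List.reverse_reverse] at this
  have h6 : applyGates M mem (hadamards (addrReg l n)) (zeroState (numQubits l n)) s =
      ((Real.sqrt 2 : ℂ) ^ (2 * l))⁻¹ := by
    rw [hadamards_zeroState M mem (nodup_addrReg l n), uniformState_addrReg, if_pos hs]
  rw [diffusionGates, applyGates_append, applyGates_append, ← hφ, h1, applyGates_hadamards_sub,
    h5]
  simp only
  rw [h6, h2]
  have h7 : ((Real.sqrt 2 : ℂ) ^ (2 * l))⁻¹ * ((Real.sqrt 2 : ℂ) ^ (2 * l))⁻¹ =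
      (2 ^ (2 * l))⁻¹ := by
    rw [← mul_inv, ← mul_pow, sqrt_two_mul_self]
  linear_combination (-2 * ∑ t, ψ t) * h7

lemma diffusionGates_eq_zero {l n : ℕ} (M : ℕ) (mem : ℕ → Vec n)
    {ψ : State (numQubits l n)} (hψ : ∀ s ∉ addrStates l n, ψ s = 0) :
    ∀ s ∉ addrStates l n, applyGates M mem (diffusionGates l n) ψ s = 0 := by
  have h1 : ∀ s ∉ addrStates l n, applyGates M mem (hadamards (addrReg l n).reverse) ψ s = 0 :=
    hadamards_eq_zero_of_notMem M mem _ (by simp) hψ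
  rw [diffusionGates, applyGates_append, applyGates_append]
  refine hadamards_eq_zero_of_notMem M mem _ (by simp) ?_
  intro s hs
  rw [applyGates_phaseOracle M mem fun g hg => isReversible_of_mem_zeroGates hg, h1 s hs,
    mul_zero]

lemma sum_twoLevel {q : ℕ} {U G : Finset (Basis q)} (hG : G ⊆ U) (a b : ℝ) :
    ∑ s, twoLevel U G a b s = G.card * a + (U.card - G.card) * b := by
  have h1 : ∀ s, twoLevel U G a b s =
      (if s ∈ U then (b : ℂ) else 0) + (if s ∈ G then ((a : ℂ) - b) else 0) := by
    intro s
    by_cases h : s ∈ G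
    · simp [twoLevel, hG h, h]
    · simp [twoLevel, h]
  simp only [h1, Finset.sum_add_distrib, Finset.sum_ite_mem, Finset.univ_inter, Finset.sum_const,
    nsmul_eq_mul]
  ring

lemma goodStates_subset (l n B w : ℕ) (mem : ℕ → Vec n) :
    goodStates l n B w mem ⊆ addrStates l n := Finset.filter_subset _ _

lemma testFlag_iff {l n B w : ℕ} (mem : ℕ → Vec n) (hB : B < 2 ^ l) (hw : w ≤ n)
    {s : Basis (numQubits l n)} (hs : s ∈ addrStates l n) :
    actGates B mem (testGates l n B) s (testFlag l n w) = true ↔ s ∈ goodStates l n B w mem := by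
  rw [(actGates_testGates mem hB hw hs).1, goodStates, Finset.mem_filter]
  simp only [hs, true_and, decide_eq_true_eq]

lemma applyGates_groverGates {l n B w : ℕ} (mem : ℕ → Vec n) (hB : B < 2 ^ l) (hw : w ≤ n)
    (a b : ℝ) :
    applyGates B mem (groverGates l n B w)
        (twoLevel (addrStates l n) (goodStates l n B w mem) a b) =
      let m := (-((goodStates l n B w mem).card * a) +
        (2 ^ (2 * l) - (goodStates l n B w mem).card) * b) / 2 ^ (2 * l)
      twoLevel (addrStates l n) (goodStates l n B w mem) (-(a + 2 * m)) (b - 2 * m) := by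
  set U := addrStates l n with hU
  set G := goodStates l n B w mem with hG
  have hGU : G ⊆ U := goodStates_subset l n B w mem
  have h1 : applyGates B mem (phaseOracle (testGates l n B) (testFlag l n w)) (twoLevel U G a b) =
      twoLevel U G (-a) b := by
    ext s
    rw [applyGates_phaseOracle B mem fun g hg => isReversible_of_mem_testGates hg]
    by_cases hs : s ∈ U
    · by_cases hg : s ∈ G
      · rw [if_pos ((testFlag_iff mem hB hw hs).mpr hg)]
        simp [twoLevel, hs, hg]
      · rw [if_neg (fun h => hg ((testFlag_iff mem hB hw hs).mp h))]
        simp [twoLevel, hs, hg]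
    · simp [twoLevel, hs]
  have h0 : ∀ s ∉ U, twoLevel U G (-a) b s = 0 := fun s hs => by simp [twoLevel, hs]
  rw [groverGates, applyGates_append, h1]
  ext s
  by_cases hs : s ∈ U
  · rw [applyGates_diffusionGates B mem h0 s hs, sum_twoLevel hGU, hU, card_addrStates, ← hU]
    by_cases hg : s ∈ G
    · simp only [twoLevel, hs, hg, if_true]
      push_cast
      ring
    · simp only [twoLevel, hs, hg, if_true, if_false]
      push_cast
      ring
  · rw [diffusionGates_eq_zero B mem h0 s hs]
    simp [twoLevel, hs]

/-- `j` Grover iterations, applied to the uniform superposition. -/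
noncomputable def searchGates (l n B w j : ℕ) : List (Gate n (numQubits l n)) :=
  hadamards (addrReg l n) ++ (List.replicate j (groverGates l n B w)).flatten

/-- The angle `θ` with `sin² θ = M / 4 ^ l`, where `M` is the number of marked address pairs. -/
noncomputable def groverAngle (l M : ℕ) : ℝ := Real.arcsin (Real.sqrt (M / 2 ^ (2 * l)))

lemma sin_groverAngle {l M : ℕ} (hM : M < 2 ^ (2 * l)) :
    Real.sin (groverAngle l M) = Real.sqrt M / Real.sqrt (2 ^ (2 * l)) := by
  have hM' : (M : ℝ) < 2 ^ (2 * l) := by exact_mod_cast hM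
  have h1 : (M : ℝ) / 2 ^ (2 * l) ≤ 1 := by
    rw [div_le_one (by positivity)]; exact hM'.le
  rw [groverAngle, Real.sin_arcsin ((by norm_num : (-1 : ℝ) ≤ 0).trans (Real.sqrt_nonneg _))
    (Real.sqrt_le_one.mpr h1), Real.sqrt_div (Nat.cast_nonneg _)]

lemma cos_groverAngle {l M : ℕ} (hM : M < 2 ^ (2 * l)) :
    Real.cos (groverAngle l M) = Real.sqrt (2 ^ (2 * l) - M) / Real.sqrt (2 ^ (2 * l)) := by
  have hM' : (M : ℝ) < 2 ^ (2 * l) := by exact_mod_cast hM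
  rw [groverAngle, Real.cos_arcsin, Real.sq_sqrt (by positivity), ← Real.sqrt_div (by linarith)]
  congr 1
  field_simp

/-- The state after `j` Grover iterations; the sign appears since the diffusion circuit is minus the
reflection about the uniform superposition. If there is no marked pair, the first amplitude is a
division by zero, but it occurs nowhere in the state. -/
lemma applyGates_searchGates {l n B w : ℕ} (mem : ℕ → Vec n) (hB : B < 2 ^ l) (hw : w ≤ n)
    (hM : (goodStates l n B w mem).card < 2 ^ (2 * l)) (j : ℕ) :
    applyGates B mem (searchGates l n B w j) (zeroState _) =
      let M := (goodStates l n B w mem).card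
      twoLevel (addrStates l n) (goodStates l n B w mem)
        ((-1) ^ j * (Real.sin ((2 * j + 1) * groverAngle l M) / Real.sqrt M))
        ((-1) ^ j * (Real.cos ((2 * j + 1) * groverAngle l M) / Real.sqrt (2 ^ (2 * l) - M))) := by
  set U := addrStates l n with hU
  set G := goodStates l n B w mem with hG
  set M := G.card with hMdef
  set θ := groverAngle l M with hθ
  have hs := sin_groverAngle hM
  have hc := cos_groverAngle hM
  rw [← hθ] at hs hc
  have hM' : (M : ℝ) < 2 ^ (2 * l) := by exact_mod_cast hM
  set x := Real.sqrt M with hx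
  set y := Real.sqrt (2 ^ (2 * l) - M) with hy
  set z := Real.sqrt (2 ^ (2 * l)) with hz
  have hx2 : (M : ℝ) = x * x := (Real.mul_self_sqrt (Nat.cast_nonneg _)).symm
  have hy2 : (2 : ℝ) ^ (2 * l) - M = y * y := (Real.mul_self_sqrt (by linarith)).symm
  have hz2 : (2 : ℝ) ^ (2 * l) = z * z := (Real.mul_self_sqrt (by positivity)).symm
  have hz0 : 0 < z := Real.sqrt_pos.mpr (by positivity)
  have hy0 : 0 < y := Real.sqrt_pos.mpr (by linarith)
  have hx0 : ∀ s ∈ G, x ≠ 0 := fun s hsG => by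
    have : 0 < M := Finset.card_pos.mpr ⟨s, hsG⟩
    exact (Real.sqrt_pos.mpr (by exact_mod_cast this)).ne'
  change applyGates B mem (searchGates l n B w j) (zeroState _) = twoLevel U G
    ((-1) ^ j * (Real.sin ((2 * j + 1) * θ) / x)) ((-1) ^ j * (Real.cos ((2 * j + 1) * θ) / y))
  induction j with
  | zero =>
    have h1 : applyGates B mem (searchGates l n B w 0) (zeroState _) =
        uniformState (addrReg l n).toFinset := by
      rw [searchGates, List.replicate_zero, List.flatten_nil, List.append_nil,
        hadamards_zeroState B mem (nodup_addrReg l n)]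
    rw [h1]
    have hzc : (Real.sqrt 2 : ℂ) ^ (2 * l) = (z : ℂ) := by
      rw [← Complex.ofReal_pow]
      congr 1
      rw [hz, pow_mul, Real.sq_sqrt (by norm_num), mul_comm, pow_mul,
        Real.sqrt_sq (by positivity)]
    ext s
    by_cases hsU : s ∈ U
    · rw [uniformState_addrReg, if_pos hsU, hzc]
      simp only [twoLevel, hsU, if_true, Nat.cast_zero, mul_zero, zero_add, one_mul, pow_zero,
        hs, hc]
      by_cases hsG : s ∈ G
      · have := hx0 s hsG
        rw [if_pos hsG, ← Complex.ofReal_inv]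
        congr 1
        field_simp
      · rw [if_neg hsG, ← Complex.ofReal_inv]
        congr 1
        field_simp
    · rw [uniformState_addrReg, if_neg hsU]
      simp [twoLevel, hsU]
  | succ j ih =>
    have h1 : (searchGates l n B w (j + 1)) = searchGates l n B w j ++ groverGates l n B w := by
      rw [searchGates, searchGates, List.replicate_succ', List.flatten_append]
      simp
    rw [h1, applyGates_append, ih, applyGates_groverGates mem hB hw, ← hG, ← hU, ← hMdef, hy2, hz2, hx2]
    set φ := (2 * (j : ℝ) + 1) * θ with hφ
    have e1 : (2 * ((j + 1 : ℕ) : ℝ) + 1) * θ = (φ + θ) + θ := by rw [hφ]; push_cast; ring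
    have e2 : φ = (φ + θ) - θ := by ring
    have e3 : (-(x * x * ((-1) ^ j * (Real.sin φ / x))) +
        y * y * ((-1) ^ j * (Real.cos φ / y))) / (z * z) =
        (-1) ^ j * (Real.cos (φ + θ) / z) := by
      have h2 : x * x * (Real.sin φ / x) = x * Real.sin φ := by
        by_cases h : x = 0
        · simp [h]
        · field_simp
      have h3 : y * y * (Real.cos φ / y) = y * Real.cos φ := by field_simp
      have h4 : -(x * x * ((-1) ^ j * (Real.sin φ / x))) +
          y * y * ((-1) ^ j * (Real.cos φ / y)) =
          (-1) ^ j * (y * Real.cos φ - x * Real.sin φ) := by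
        linear_combination (-1) ^ j * h3 - (-1) ^ j * h2
      rw [h4, Real.cos_add, hs, hc]
      field_simp
    simp only [e3, e1]
    ext s
    by_cases hsU : s ∈ U
    · simp only [twoLevel, hsU, if_true]
      by_cases hsG : s ∈ G
      · have hx0' := hx0 s hsG
        rw [if_pos hsG, if_pos hsG]
        congr 1
        have h4 : Real.sin (φ + θ + θ) = Real.sin φ + 2 * Real.cos (φ + θ) * Real.sin θ := by
          conv_rhs => rw [e2]
          rw [Real.sin_add (φ + θ) θ, Real.sin_sub]
          ring_nf
        rw [h4, hs, pow_succ]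
        field_simp
      · rw [if_neg hsG, if_neg hsG]
        congr 1
        have h4 : Real.cos (φ + θ + θ) = -Real.cos φ + 2 * Real.cos (φ + θ) * Real.cos θ := by
          conv_rhs => rw [e2]
          rw [Real.cos_add (φ + θ) θ, Real.cos_sub]
          ring_nf
        rw [h4, hc, pow_succ]
        field_simp
        ring
    · simp [twoLevel, hsU]

/-! ### Measurements -/

lemma sqNorm_smul {q : ℕ} (c : ℂ) (ψ : State q) :
    sqNorm (fun s => c * ψ s) = ‖c‖ ^ 2 * sqNorm ψ := by
  simp [sqNorm, mul_pow, Finset.mul_sum]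

lemma sqNorm_zeroState (q : ℕ) : sqNorm (zeroState q) = 1 := by
  have : ∀ s : Basis q, ‖zeroState q s‖ ^ 2 = if s = (fun _ => false) then 1 else 0 := by
    intro s
    unfold zeroState
    split_ifs <;> simp
  simp [sqNorm, this]

lemma proj_smul {q : ℕ} (P : Basis q → Prop) [DecidablePred P] (c : ℂ) (ψ : State q) :
    proj P (fun s => c * ψ s) = fun s => c * proj P ψ s := by
  ext s
  simp [proj]

lemma flipIf_smul {q : ℕ} (t : Fin q) (φ : Basis q → Bool) (c : ℂ) (ψ : State q) :
    flipIf t φ (fun s => c * ψ s) = fun s => c * flipIf t φ ψ s := rfl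

lemma Gate.apply_smul {n q : ℕ} (M : ℕ) (mem : ℕ → Vec n) (g : Gate n q) (c : ℂ) (ψ : State q) :
    g.apply M mem (fun s => c * ψ s) = fun s => c * g.apply M mem ψ s := by
  cases g <;> ext s <;> simp only [Gate.apply, flipIf_smul] <;> ring

/-- Running from a scaled state scales the expectation by the squared modulus. -/
lemma expectFrom_smul {n q : ℕ} (M : ℕ) (mem : ℕ → Vec n) (F : List (ℕ × ℕ) → ℕ → ℝ)
    (L : List (Op n q)) (c : ℂ) (ψ : State q) (out : List (ℕ × ℕ)) (τ : ℕ) :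
    expectFrom M mem F L (fun s => c * ψ s) out τ = ‖c‖ ^ 2 * expectFrom M mem F L ψ out τ := by
  induction L generalizing ψ out τ with
  | nil => simp only [expectFrom, sqNorm_smul]; ring
  | cons op L ih =>
    cases op with
    | gate g => simp only [expectFrom, Gate.apply_smul, ih]
    | reset i => simp only [expectFrom, proj_smul, flipIf_smul, ih]; ring
    | emit f I J => simp only [expectFrom, proj_smul, ih, mul_add, Finset.mul_sum]
    | halt i => simp only [expectFrom, proj_smul, sqNorm_smul, ih]; ring

lemma sqNorm_flipIf_not {q : ℕ} (i : Fin q) (ψ : State q) :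
    sqNorm (flipIf i (fun _ => true) ψ) = sqNorm ψ :=
  Equiv.sum_comp (Function.Involutive.toPerm _ (flipBit_true_bij i)) fun s => ‖ψ s‖ ^ 2

lemma sqNorm_proj_add {q : ℕ} (i : Fin q) (ψ : State q) :
    sqNorm (proj (fun s => s i = false) ψ) + sqNorm (proj (fun s => s i = true) ψ) = sqNorm ψ := by
  simp only [sqNorm, ← Finset.sum_add_distrib]
  refine Finset.sum_congr rfl fun s _ => ?_
  cases h : s i <;> simp [proj, h]

/-- Resetting all qubits in which a state is not clean leads back to the zero state in every
branch. -/
lemma expectFrom_resets {n q : ℕ} (M : ℕ) (mem : ℕ → Vec n) (F : List (ℕ × ℕ) → ℕ → ℝ)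
    (L : List (Op n q)) (out : List (ℕ × ℕ)) (I : List (Fin q)) (ψ : State q) (τ : ℕ)
    (hψ : ∀ s, ψ s ≠ 0 → ∀ x ∉ I, s x = false) :
    expectFrom M mem F (I.map Op.reset ++ L) ψ out τ =
      sqNorm ψ * expectFrom M mem F L (zeroState q) out (τ + I.length) := by
  induction I generalizing ψ τ with
  | nil =>
    have h1 : ψ = fun s => ψ (fun _ => false) * zeroState q s := by
      ext s
      by_cases h : s = fun _ => false
      · simp [h, zeroState]
      · have : ψ s = 0 := by
          by_contra h0
          exact h (funext fun x => hψ s h0 x (by simp))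
        simp [zeroState, h, this]
    rw [List.map_nil, List.nil_append, List.length_nil, add_zero, h1, expectFrom_smul,
      sqNorm_smul, sqNorm_zeroState, mul_one]
  | cons i I ih =>
    simp only [List.map_cons, List.cons_append, expectFrom, Op.cost, List.length_cons]
    rw [ih, ih, sqNorm_flipIf_not, ← add_mul, sqNorm_proj_add,
      show τ + 1 + I.length = τ + (I.length + 1) by ring]
    · intro s hs x hx
      have hs' : proj (fun s => s i = true) ψ (flipBit i true s) ≠ 0 := hs
      simp only [proj, flipBit_self, ne_eq, ite_eq_right_iff, Classical.not_imp] at hs'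
      by_cases hxi : x = i
      · subst hxi; simpa using hs'.1
      · rw [← hψ _ hs'.2 x (by simp [hxi, hx]), flipBit_of_ne hxi]
    · intro s hs x hx
      simp only [proj, ne_eq, ite_eq_right_iff, Classical.not_imp] at hs
      by_cases hxi : x = i
      · rw [hxi]; exact hs.1
      · exact hψ s hs.2 x (by simp [hxi, hx])

/-! ### Address pairs and solution pairs -/

lemma regVal_inj {q : ℕ} {I : List (Fin q)} {s s' : Basis q} (h : regVal I s = regVal I s') :
    ∀ x ∈ I, s x = s' x := by
  induction I with
  | nil => simp
  | cons x I ih =>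
    rw [regVal_cons, regVal_cons] at h
    have h1 : (s x).toNat = (s' x).toNat ∧ regVal I s = regVal I s' := by
      have := Bool.toNat_lt (s x)
      have := Bool.toNat_lt (s' x)
      omega
    intro y hy
    rcases List.mem_cons.mp hy with rfl | hy
    · have h2 := h1.1
      revert h2
      cases s y <;> cases s' y <;> simp
    · exact ih h1.2 y hy

/-- The pair of addresses of a basis state. -/
noncomputable def addrPair {l n : ℕ} (s : Basis (numQubits l n)) : ℕ × ℕ :=
  (regVal (leftReg l n) s, regVal (rightReg l n) s)

lemma addrPair_injOn (l n : ℕ) :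
    Set.InjOn (addrPair (l := l) (n := n)) (addrStates l n : Set (Basis (numQubits l n))) := by
  intro s hs s' hs' h
  rw [Finset.mem_coe, addrStates, mem_cleanStates] at hs hs'
  simp only [List.mem_toFinset] at hs hs'
  have h' := Prod.mk.inj h
  ext x
  by_cases hx : x ∈ addrReg l n
  · rcases List.mem_append.mp hx with hx | hx
    · exact regVal_inj h'.1 x hx
    · exact regVal_inj h'.2 x hx
  · rw [hs x hx, hs' x hx]

lemma exists_addrPair_eq {l n a b : ℕ} (ha : a < 2 ^ l) (hb : b < 2 ^ l) :
    ∃ s ∈ addrStates l n, addrPair s = (a, b) := by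
  let bit : Wire l n → Bool
    | .inl (.inl k) => a.testBit k
    | .inl (.inr k) => b.testBit k
    | _ => false
  refine ⟨fun x => bit (wire.symm x), ?_, ?_⟩
  · rw [addrStates, mem_cleanStates]
    simp only [List.mem_toFinset]
    intro x hx
    obtain ⟨y, rfl⟩ := wire.surjective x
    rw [Equiv.symm_apply_apply]
    rcases y with (k | k) | y
    · exact absurd (List.mem_append_left _ (mem_leftReg.mpr ⟨k, rfl⟩)) hx
    · exact absurd (List.mem_append_right _ (mem_rightReg.mpr ⟨k, rfl⟩)) hx
    · rfl
  · refine Prod.ext ?_ ?_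
    · rw [← ofDigits_testBit l a ha]
      simp [addrPair, regVal, leftReg, leftBit, Function.comp_def, bit]
    · rw [← ofDigits_testBit l b hb]
      simp [addrPair, regVal, rightReg, rightBit, Function.comp_def, bit]

lemma load_val {B n : ℕ} (X : Fin B → Vec n) (i : Fin B) : load X i = X i := by
  simp [load]

lemma mem_solutions {B n w : ℕ} (X : Fin B → Vec n) (ab : ℕ × ℕ) :
    ab ∈ solutions w X ↔
      ab.1 < ab.2 ∧ ab.2 < B ∧ hammingNorm (load X ab.1 + load X ab.2) = w := by
  simp only [solutions, Finset.mem_image, Finset.mem_filter, Finset.mem_univ, true_and,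
    Prod.exists]
  constructor
  · rintro ⟨i, j, ⟨hij, h⟩, rfl⟩
    simp only [load_val]
    exact ⟨hij, j.2, h⟩
  · rintro ⟨h1, h2, h3⟩
    refine ⟨⟨ab.1, h1.trans h2⟩, ⟨ab.2, h2⟩, ⟨h1, ?_⟩, rfl⟩
    rwa [← load_val X ⟨ab.1, h1.trans h2⟩, ← load_val X ⟨ab.2, h2⟩]

lemma mem_goodStates {l B n w : ℕ} (X : Fin B → Vec n) (s : Basis (numQubits l n)) :
    s ∈ goodStates l n B w (load X) ↔ s ∈ addrStates l n ∧ addrPair s ∈ solutions w X := by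
  rw [goodStates, Finset.mem_filter, mem_solutions]
  rfl

lemma card_filter_goodStates {l B n w : ℕ} (X : Fin B → Vec n) (hB : B < 2 ^ l) (ab : ℕ × ℕ) :
    ((goodStates l n B w (load X)).filter fun s => addrPair s = ab).card =
      if ab ∈ solutions w X then 1 else 0 := by
  split_ifs with h
  · have h' := (mem_solutions X ab).mp h
    obtain ⟨s, hs, hsab⟩ := exists_addrPair_eq (n := n)
      ((h'.1.trans h'.2.1).trans hB) (h'.2.1.trans hB)
    rw [Finset.card_eq_one]
    refine ⟨s, ?_⟩
    ext t
    simp only [Finset.mem_filter, mem_goodStates, Finset.mem_singleton]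
    constructor
    · rintro ⟨⟨ht, -⟩, ht'⟩
      exact addrPair_injOn l n ht hs (ht'.trans hsab.symm)
    · rintro rfl
      exact ⟨⟨hs, hsab ▸ h⟩, hsab⟩
  · rw [Finset.card_eq_zero, Finset.filter_eq_empty_iff]
    rintro s hs rfl
    exact h ((mem_goodStates X s).mp hs).2

lemma card_goodStates {l B n w : ℕ} (X : Fin B → Vec n) (hB : B < 2 ^ l) :
    (goodStates l n B w (load X)).card = (solutions w X).card := by
  refine Finset.card_bij' (fun s _ => addrPair s)
    (fun ab h => (exists_addrPair_eq (l := l) (n := n)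
      ((((mem_solutions X ab).mp h).1.trans ((mem_solutions X ab).mp h).2.1).trans hB)
      (((mem_solutions X ab).mp h).2.1.trans hB)).choose) ?_ ?_ ?_ ?_
  · exact fun s hs => ((mem_goodStates X s).mp hs).2
  · intro ab h
    generalize_proofs hex
    obtain ⟨h1, h2⟩ := hex.choose_spec
    exact (mem_goodStates X _).mpr ⟨h1, by rw [h2]; exact h⟩
  · intro s hs
    generalize_proofs hex
    obtain ⟨h1, h2⟩ := hex.choose_spec
    exact addrPair_injOn l n h1 ((mem_goodStates X s).mp hs).1 h2
  · intro ab h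
    generalize_proofs hex
    exact hex.choose_spec.2

lemma card_solutions_lt {l B n w : ℕ} (X : Fin B → Vec n) (hB : B < 2 ^ l) :
    (solutions w X).card < 2 ^ (2 * l) := by
  rw [← card_goodStates (l := l) X hB, ← card_addrStates l n]
  refine Finset.card_lt_card ⟨goodStates_subset _ _ _ _ _, fun h => ?_⟩
  have h0 : (fun _ => false) ∈ addrStates l n := by simp [addrStates, mem_cleanStates]
  have h1 := (Finset.mem_filter.mp (h h0)).2.1
  have hz : ∀ I : List (Fin (numQubits l n)), regVal I (fun _ => false) = 0 := by
    intro I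
    induction I with
    | nil => rfl
    | cons x I ih => rw [regVal_cons, ih]; rfl
  rw [hz, hz] at h1
  exact lt_irrefl _ h1

/-! ### One search -/

/-- One search: `j` Grover iterations, the test, the output of the two addresses if the test
succeeds, and the reset of all qubits. -/
noncomputable def trial (l n B w j : ℕ) : List (Op n (numQubits l n)) :=
  (searchGates l n B w j ++ testGates l n B).map Op.gate ++
    ([.emit (testFlag l n w) (leftReg l n) (rightReg l n)] ++
      (List.finRange (numQubits l n)).map .reset)

/-- The number of steps of one search. -/
noncomputable def trialCost (l n B w j : ℕ) : ℕ :=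
  gateCost (searchGates l n B w j ++ testGates l n B) + (1 + l + l) + numQubits l n

/-- The probability that a search with `j` Grover iterations finds one of `M` solutions. -/
noncomputable def hitProb (l M j : ℕ) : ℝ := Real.sin ((2 * j + 1) * groverAngle l M) ^ 2

lemma sqNorm_proj_applyGates {n q : ℕ} (M : ℕ) (mem : ℕ → Vec n) {gs : List (Gate n q)}
    (hgs : ∀ g ∈ gs, g.IsReversible) (P : Basis q → Prop) [DecidablePred P] (ψ : State q) :
    sqNorm (proj P (applyGates M mem gs ψ)) =
      ∑ s, if P (actGates M mem gs s) then ‖ψ s‖ ^ 2 else 0 := by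
  rw [sqNorm, ← Equiv.sum_comp (actEquiv M mem gs)]
  refine Finset.sum_congr rfl fun s _ => ?_
  change ‖proj P (applyGates M mem gs ψ) (actGates M mem gs s)‖ ^ 2 = _
  rw [proj, applyGates_actGates M mem hgs]
  split_ifs <;> simp

/-- A search outputs a uniformly random solution with probability `hitProb`, and nothing
otherwise; then it starts afresh. -/
lemma expectFrom_trial {l B n w : ℕ} (X : Fin B → Vec n) (hB : B < 2 ^ l) (hw : w ≤ n) (j : ℕ)
    (F : List (ℕ × ℕ) → ℕ → ℝ) (L : List (Op n (numQubits l n))) (out : List (ℕ × ℕ)) (τ : ℕ) :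
    expectFrom B (load X) F (trial l n B w j ++ L) (zeroState _) out τ =
      (1 - hitProb l (solutions w X).card j) *
          expectFrom B (load X) F L (zeroState _) out (τ + trialCost l n B w j) +
        ∑ ab ∈ solutions w X, hitProb l (solutions w X).card j / (solutions w X).card *
          expectFrom B (load X) F L (zeroState _) (out ++ [ab]) (τ + trialCost l n B w j) := by
  have hlt := card_solutions_lt (l := l) (w := w) X hB
  have hgc := card_goodStates (l := l) (w := w) X hB
  set U := addrStates l n with hU
  set G := goodStates l n B w (load X) with hG
  set M := (solutions w X).card with hM
  have hlt' : (M : ℝ) < 2 ^ (2 * l) := by exact_mod_cast hlt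
  have hst := applyGates_searchGates (l := l) (load X) hB hw (by rw [← hG, hgc]; exact hlt) j
  simp only [← hG, ← hU, hgc] at hst
  set a := (-1) ^ j * (Real.sin ((2 * j + 1) * groverAngle l M) / Real.sqrt M) with ha
  set b := (-1) ^ j * (Real.cos ((2 * j + 1) * groverAngle l M) / Real.sqrt (2 ^ (2 * l) - M))
    with hb
  have hsign : (((-1 : ℝ)) ^ j) ^ 2 = 1 := by
    rw [← pow_mul, mul_comm, pow_mul]; norm_num
  have ha2 : a ^ 2 = hitProb l M j / M := by
    rw [ha, mul_pow, hsign, one_mul, div_pow, Real.sq_sqrt (Nat.cast_nonneg _), hitProb]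
  have hb2 : (2 ^ (2 * l) - M) * b ^ 2 = 1 - hitProb l M j := by
    rw [hb, mul_pow, hsign, one_mul, div_pow, Real.sq_sqrt (by linarith), hitProb,
      ← Real.cos_sq', mul_div_cancel₀]
    linarith
  have hrev : ∀ g ∈ testGates l n B, g.IsReversible := fun g hg => isReversible_of_mem_testGates hg
  have hreset : ∀ (ψ : State (numQubits l n)) (o : List (ℕ × ℕ)) (t : ℕ),
      expectFrom B (load X) F ((List.finRange (numQubits l n)).map .reset ++ L) ψ o t =
        sqNorm ψ * expectFrom B (load X) F L (zeroState _) o (t + numQubits l n) := by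
    intro ψ o t
    rw [expectFrom_resets _ _ _ _ _ _ _ _ fun s _ x hx => absurd (List.mem_finRange x) hx,
      List.length_finRange]
  have hcost : τ + gateCost (searchGates l n B w j ++ testGates l n B) + (1 + l + l) +
      numQubits l n = τ + trialCost l n B w j := by
    rw [trialCost]; ring
  rw [trial, List.append_assoc, expectFrom_gates, applyGates_append, hst, List.append_assoc,
    List.singleton_append]
  simp only [expectFrom, hreset, Op.cost, length_leftReg, length_rightReg, hcost]
  congr 1
  · congr 1
    rw [sqNorm_proj_applyGates _ _ hrev, ← hb2]
    have h1 : ∀ s, (if actGates B (load X) (testGates l n B) s (testFlag l n w) = false then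
        ‖twoLevel U G a b s‖ ^ 2 else 0) = if s ∈ U \ G then b ^ 2 else 0 := by
      intro s
      by_cases hs : s ∈ U
      · by_cases hg : s ∈ G
        · rw [(testFlag_iff (load X) hB hw hs).mpr hg]
          simp [hg]
        · have : actGates B (load X) (testGates l n B) s (testFlag l n w) = false := by
            rw [← Bool.not_eq_true, testFlag_iff (load X) hB hw hs]
            exact hg
          simp [this, hs, hg, twoLevel]
      · simp [twoLevel, hs]
    rw [Finset.sum_congr rfl fun s _ => h1 s, Finset.sum_ite_mem, Finset.univ_inter,
      Finset.sum_const, nsmul_eq_mul, Finset.card_sdiff_of_subset (goodStates_subset _ _ _ _ _),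
      hgc, card_addrStates, Nat.cast_sub hlt.le]
    push_cast
    rfl
  · have h2 : ∀ x y : ℕ, sqNorm (proj (fun s => s (testFlag l n w) = true ∧
        regVal (leftReg l n) s = x ∧ regVal (rightReg l n) s = y)
        (applyGates B (load X) (testGates l n B) (twoLevel U G a b))) =
        if (x, y) ∈ solutions w X then hitProb l M j / M else 0 := by
      intro x y
      rw [sqNorm_proj_applyGates _ _ hrev]
      have h1 : ∀ s, (if actGates B (load X) (testGates l n B) s (testFlag l n w) = true ∧
          regVal (leftReg l n) (actGates B (load X) (testGates l n B) s) = x ∧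
          regVal (rightReg l n) (actGates B (load X) (testGates l n B) s) = y then
          ‖twoLevel U G a b s‖ ^ 2 else 0) =
          if s ∈ G.filter (fun s => addrPair s = (x, y)) then a ^ 2 else 0 := by
        intro s
        by_cases hs : s ∈ U
        · have h3 := (actGates_testGates (w := w) (load X) hB hw hs).2
          have hL : regVal (leftReg l n) (actGates B (load X) (testGates l n B) s) =
              regVal (leftReg l n) s :=
            regVal_congr fun x hx => h3 x (List.mem_append_left _ hx)
          have hR : regVal (rightReg l n) (actGates B (load X) (testGates l n B) s) =
              regVal (rightReg l n) s :=
            regVal_congr fun x hx => h3 x (List.mem_append_right _ hx)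
          have hT := testFlag_iff (load X) hB hw hs
          by_cases hg : s ∈ G
          · rw [hL, hR, hT.mpr hg]
            simp [hg, hs, twoLevel, addrPair]
          · rw [if_neg fun h => hg (hT.mp h.1)]
            simp [hg]
        · have hg : s ∉ G := fun h => hs (goodStates_subset _ _ _ _ _ h)
          simp [twoLevel, hs, hg]
      rw [Finset.sum_congr rfl fun s _ => h1 s, Finset.sum_ite_mem, Finset.univ_inter,
        Finset.sum_const, nsmul_eq_mul, card_filter_goodStates X hB, ha2]
      split_ifs <;> simp
    simp only [h2]
    rw [← Finset.sum_product' (Finset.range (2 ^ l)) (Finset.range (2 ^ l)) fun x y =>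
      (if (x, y) ∈ solutions w X then hitProb l M j / M else 0) *
        expectFrom B (load X) F L (zeroState _) (out ++ [(x, y)]) (τ + trialCost l n B w j)]
    symm
    refine Finset.sum_subset_zero_on_sdiff (fun ab hab => ?_) (fun ab hab => ?_) fun ab hab => ?_
    · obtain ⟨h3, h4, -⟩ := (mem_solutions X ab).mp hab
      simp only [Finset.mem_product, Finset.mem_range]
      exact ⟨(h3.trans h4).trans hB, h4.trans hB⟩
    · rw [Finset.mem_sdiff] at hab
      rw [if_neg hab.2, zero_mul]
    · rw [if_pos hab]

/-! ### The random list -/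

lemma hammingNorm_comp_equiv {n : ℕ} (σ : Equiv.Perm (Fin n)) (x : Vec n) :
    hammingNorm (fun k => x (σ k)) = hammingNorm x := by
  unfold hammingNorm
  exact Finset.card_equiv σ (by simp)

lemma exists_perm_of_hammingNorm_eq {n : ℕ} {c c' : Vec n} (h : hammingNorm c = hammingNorm c') :
    ∃ σ : Equiv.Perm (Fin n), ∀ k, c (σ k) = c' k := by
  have hcard : Fintype.card {k // c' k ≠ 0} = Fintype.card {k // c k ≠ 0} := by
    rw [Fintype.card_subtype, Fintype.card_subtype]
    exact h.symm
  obtain ⟨e⟩ := Fintype.card_eq.mp hcard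
  refine ⟨e.extendSubtype, fun k => ?_⟩
  have h2 : ∀ a b : ZMod 2, (a ≠ 0 ↔ b ≠ 0) → a = b := by decide
  refine h2 _ _ ⟨fun h => ?_, fun h => e.extendSubtype_mem k h⟩
  by_contra h'
  exact e.extendSubtype_not_mem k (not_not.mpr h') h

/-- The probability `solutionProb` depends on the center only through its weight. -/
lemma solutionProb_eq_of_hammingNorm_eq {n : ℕ} (w α : ℕ) {c c' : Vec n}
    (h : hammingNorm c = hammingNorm c') : solutionProb w α c = solutionProb w α c' := by
  obtain ⟨σ, hσ⟩ := exists_perm_of_hammingNorm_eq h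
  let e : Vec n ≃ Vec n := σ.symm.arrowCongr (Equiv.refl _)
  have he : ∀ x k, e x k = x (σ k) := fun x k => rfl
  have he1 : ∀ x, hammingNorm (e x) = hammingNorm x := fun x => hammingNorm_comp_equiv σ x
  have hmem : ∀ x, x ∈ region w α c ↔ e x ∈ region w α c' := by
    intro x
    have h1 : e x * c' = e (x * c) := by
      ext k
      simp [he, hσ]
    simp only [region, sphere, Finset.mem_filter, Finset.mem_univ, true_and, he1, h1]
  have hadd : ∀ x y, e x + e y = e (x + y) := fun x y => rfl
  rw [solutionProb, solutionProb, Finset.card_equiv e hmem]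
  congr 2
  refine Finset.card_equiv (e.prodCongr e) fun xy => ?_
  simp only [Finset.mem_filter, Finset.mem_product, Equiv.prodCongr_apply, Prod.map, hadd, he1,
    hmem]

lemma solutionProb_nonneg {n : ℕ} (w α : ℕ) (c : Vec n) : 0 ≤ solutionProb w α c := by
  unfold solutionProb; positivity

/-- Two entries of a uniformly random list are independent and uniformly random. -/
lemma card_pair_filter {ι V : Type*} [Fintype ι] [DecidableEq ι] [DecidableEq V] (R : Finset V)
    {i j : ι} (hij : i ≠ j) (P : V → V → Prop) [DecidableRel P] :
    ((Fintype.piFinset fun _ : ι => R).filter fun X => P (X i) (X j)).card * R.card ^ 2 =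
      (Fintype.piFinset fun _ : ι => R).card * ((R ×ˢ R).filter fun xy => P xy.1 xy.2).card := by
  set L := Fintype.piFinset fun _ : ι => R with hL
  set m := ∏ k : ι, if k = i ∨ k = j then 1 else R.card with hm
  -- the number of lists with prescribed entries `i` and `j` does not depend on these entries
  have hfib : ∀ xy ∈ R ×ˢ R, (L.filter fun X => (X i, X j) = xy).card = m := by
    intro xy hxy
    rw [Finset.mem_product] at hxy
    have h1 : (L.filter fun X => (X i, X j) = xy) =
        Fintype.piFinset fun k => if k = i then {xy.1} else if k = j then {xy.2} else R := by
      ext X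
      simp only [hL, Finset.mem_filter, Fintype.mem_piFinset]
      constructor
      · rintro ⟨h, rfl⟩ k
        split_ifs with h1 h2
        · simp [h1]
        · simp [h2]
        · exact h k
      · intro h
        have hi := h i
        have hj := h j
        simp only [if_true, Finset.mem_singleton, if_neg hij.symm] at hi hj
        refine ⟨fun k => ?_, Prod.ext hi hj⟩
        by_cases h1 : k = i
        · rw [h1, hi]; exact hxy.1
        · by_cases h2 : k = j
          · rw [h2, hj]; exact hxy.2
          · simpa [h1, h2] using h k
    rw [h1, Fintype.card_piFinset, hm]
    refine Finset.prod_congr rfl fun k _ => ?_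
    by_cases h1 : k = i
    · simp [h1]
    · by_cases h2 : k = j
      · simp [h2, hij.symm]
      · simp [h1, h2]
  have hmaps : ∀ X ∈ L, (X i, X j) ∈ R ×ˢ R := fun X hX => by
    rw [hL, Fintype.mem_piFinset] at hX
    exact Finset.mem_product.mpr ⟨hX i, hX j⟩
  have h1 : L.card = R.card ^ 2 * m := by
    rw [Finset.card_eq_sum_card_fiberwise hmaps, Finset.sum_congr rfl hfib, Finset.sum_const,
      Finset.card_product, smul_eq_mul, sq]
  have h2 : (L.filter fun X => P (X i) (X j)).card =
      ((R ×ˢ R).filter fun xy => P xy.1 xy.2).card * m := by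
    rw [Finset.card_eq_sum_card_fiberwise (f := fun X => (X i, X j))
      (t := (R ×ˢ R).filter fun xy => P xy.1 xy.2)]
    · rw [← smul_eq_mul, ← Finset.sum_const]
      refine Finset.sum_congr rfl fun xy hxy => ?_
      rw [Finset.mem_filter] at hxy
      rw [← hfib xy hxy.1, Finset.filter_filter]
      congr 1
      ext X
      simp only [Finset.mem_filter, and_congr_right_iff, and_iff_right_iff_imp]
      rintro - rfl
      exact hxy.2
    · intro X hX
      rw [Finset.mem_coe, Finset.mem_filter] at hX
      exact Finset.mem_coe.mpr (Finset.mem_filter.mpr ⟨hmaps X hX.1, hX.2⟩)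
  rw [h1, h2]
  ring

lemma bucketLists_nonempty {n : ℕ} (B : ℕ) {w α : ℕ} {c : Vec n} (h : (region w α c).Nonempty) :
    (bucketLists B w α c).Nonempty := by
  obtain ⟨x, hx⟩ := h
  exact ⟨fun _ => x, Fintype.mem_piFinset.mpr fun _ => hx⟩

/-- The expected number of solutions is at most `B² p`. -/
lemma sum_card_solutions_le {n : ℕ} (B : ℕ) {w α : ℕ} {c : Vec n}
    (h : (region w α c).Nonempty) :
    (∑ X ∈ bucketLists B w α c, ((solutions w X).card : ℝ)) ≤
      (bucketLists B w α c).card * ((B : ℝ) ^ 2 * solutionProb w α c) := by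
  have hr : (0 : ℝ) < (region w α c).card := by exact_mod_cast h.card_pos
  have h1 : ∀ X : Fin B → Vec n, ((solutions w X).card : ℝ) ≤
      ∑ ij : Fin B × Fin B, if ij.1 < ij.2 ∧ hammingNorm (X ij.1 + X ij.2) = w then 1 else 0 := by
    intro X
    rw [Finset.sum_boole]
    exact_mod_cast Finset.card_image_le
  have h2 : ∀ ij : Fin B × Fin B, (∑ X ∈ bucketLists B w α c,
      if ij.1 < ij.2 ∧ hammingNorm (X ij.1 + X ij.2) = w then (1 : ℝ) else 0) ≤
      (bucketLists B w α c).card * solutionProb w α c := by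
    intro ij
    by_cases hij : ij.1 < ij.2
    · simp only [hij, true_and]
      rw [Finset.sum_boole]
      have h3 := card_pair_filter (region w α c) hij.ne
        fun x y : Vec n => hammingNorm (x + y) = w
      have h4 : (((bucketLists B w α c).filter fun X =>
          hammingNorm (X ij.1 + X ij.2) = w).card : ℝ) * ((region w α c).card : ℝ) ^ 2 =
          (bucketLists B w α c).card * (((region w α c ×ˢ region w α c).filter fun xy =>
            hammingNorm (xy.1 + xy.2) = w).card : ℝ) := by exact_mod_cast h3
      rw [solutionProb, mul_div_assoc', le_div_iff₀ (by positivity), h4]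
    · simp only [hij, false_and, if_false, Finset.sum_const_zero]
      exact mul_nonneg (Nat.cast_nonneg _) (solutionProb_nonneg w α c)
  calc (∑ X ∈ bucketLists B w α c, ((solutions w X).card : ℝ))
      ≤ ∑ X ∈ bucketLists B w α c, ∑ ij : Fin B × Fin B,
          if ij.1 < ij.2 ∧ hammingNorm (X ij.1 + X ij.2) = w then (1 : ℝ) else 0 :=
        Finset.sum_le_sum fun X _ => h1 X
    _ = ∑ ij : Fin B × Fin B, ∑ X ∈ bucketLists B w α c,
          if ij.1 < ij.2 ∧ hammingNorm (X ij.1 + X ij.2) = w then (1 : ℝ) else 0 :=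
        Finset.sum_comm
    _ ≤ ∑ _ij : Fin B × Fin B, (bucketLists B w α c).card * solutionProb w α c :=
        Finset.sum_le_sum fun ij _ => h2 ij
    _ = (bucketLists B w α c).card * ((B : ℝ) ^ 2 * solutionProb w α c) := by
        rw [Finset.sum_const, Finset.card_univ, Fintype.card_prod, Fintype.card_fin, nsmul_eq_mul]
        push_cast
        ring

/-- Markov's inequality for the number of solutions: if the success probability `f X` on a list
is at least `1 - δ` whenever the list has fewer than `m` solutions, then the overall success
probability is at least `1 - δ - B² p / m`. -/
lemma le_expect_of_few_solutions {n : ℕ} (B : ℕ) {w α : ℕ} {c : Vec n}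
    (h : (region w α c).Nonempty) {m δ : ℝ} (hm : 0 < m) (hδ : 0 ≤ δ) (f : (Fin B → Vec n) → ℝ)
    (hf0 : ∀ X, 0 ≤ f X) (hf : ∀ X, ((solutions w X).card : ℝ) < m → 1 - δ ≤ f X) :
    1 - δ - (B : ℝ) ^ 2 * solutionProb w α c / m ≤ Finset.expect (bucketLists B w α c) f := by
  have hL : (0 : ℝ) < (bucketLists B w α c).card := by
    exact_mod_cast (bucketLists_nonempty B h).card_pos
  have h1 : ∀ X, 1 - δ - (solutions w X).card / m ≤ f X := by
    intro X
    by_cases hX : ((solutions w X).card : ℝ) < m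
    · have : 0 ≤ ((solutions w X).card : ℝ) / m := by positivity
      linarith [hf X hX]
    · have : 1 ≤ ((solutions w X).card : ℝ) / m := by
        rw [le_div_iff₀ hm]; linarith
      linarith [hf0 X]
  rw [Finset.expect_eq_sum_div_card, le_div_iff₀ hL]
  calc (1 - δ - (B : ℝ) ^ 2 * solutionProb w α c / m) * (bucketLists B w α c).card
      = (1 - δ) * (bucketLists B w α c).card -
          ((bucketLists B w α c).card * ((B : ℝ) ^ 2 * solutionProb w α c)) / m := by ring
    _ ≤ (1 - δ) * (bucketLists B w α c).card -
          (∑ X ∈ bucketLists B w α c, ((solutions w X).card : ℝ)) / m := by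
        gcongr
        exact sum_card_solutions_le B h
    _ = ∑ X ∈ bucketLists B w α c, (1 - δ - (solutions w X).card / m) := by
        rw [Finset.sum_sub_distrib, Finset.sum_const, nsmul_eq_mul, Finset.sum_div]
        ring
    _ ≤ ∑ X ∈ bucketLists B w α c, f X := Finset.sum_le_sum fun X _ => h1 X

/-! ### Sequences of searches -/

/-- Searches with the numbers of Grover iterations given by the list `js`. -/
noncomputable def trials (l n B w : ℕ) (js : List ℕ) : List (Op n (numQubits l n)) :=
  js.flatMap (trial l n B w)

lemma hitProb_nonneg (l M j : ℕ) : 0 ≤ hitProb l M j := sq_nonneg _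

lemma hitProb_le_one (l M j : ℕ) : hitProb l M j ≤ 1 := Real.sin_sq_le_one _

lemma card_mul_hitProb_div (l M j : ℕ) : M * (hitProb l M j / M) = hitProb l M j := by
  by_cases h : M = 0
  · subst h
    simp [hitProb, groverAngle]
  · field_simp

lemma trials_cons (l n B w j : ℕ) (js : List ℕ) :
    trials l n B w (j :: js) = trial l n B w j ++ trials l n B w js := rfl

/-- The running time of a sequence of searches does not depend on the measurement outcomes. -/
lemma expectFrom_trials_time {l B n w : ℕ} (X : Fin B → Vec n) (hB : B < 2 ^ l) (hw : w ≤ n)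
    (js : List ℕ) (out : List (ℕ × ℕ)) (τ : ℕ) :
    expectFrom B (load X) (fun _ τ => (τ : ℝ)) (trials l n B w js) (zeroState _) out τ =
      τ + (js.map fun j => (trialCost l n B w j : ℝ)).sum := by
  induction js generalizing out τ with
  | nil => simp [trials, expectFrom, sqNorm_zeroState]
  | cons j js ih =>
    rw [trials_cons, expectFrom_trial X hB hw]
    simp only [ih, List.map_cons, List.sum_cons, Finset.sum_const, nsmul_eq_mul]
    rw [← mul_assoc, card_mul_hitProb_div]
    push_cast
    ring

lemma expectFrom_trials_nonneg {l B n w : ℕ} (X : Fin B → Vec n) (hB : B < 2 ^ l) (hw : w ≤ n)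
    {F : List (ℕ × ℕ) → ℕ → ℝ} (hF : ∀ out τ, 0 ≤ F out τ)
    (js : List ℕ) (out : List (ℕ × ℕ)) (τ : ℕ) :
    0 ≤ expectFrom B (load X) F (trials l n B w js) (zeroState _) out τ := by
  induction js generalizing out τ with
  | nil => simp [trials, expectFrom, sqNorm_zeroState, hF]
  | cons j js ih =>
    rw [trials_cons, expectFrom_trial X hB hw]
    have h1 := hitProb_le_one l (solutions w X).card j
    have h0 := hitProb_nonneg l (solutions w X).card j
    exact add_nonneg (mul_nonneg (by linarith) (ih _ _))
      (Finset.sum_nonneg fun ab _ => mul_nonneg (by positivity) (ih _ _))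

/-- The probability that a given solution is not output by a sequence of searches. -/
lemma expectFrom_trials_miss {l B n w : ℕ} (X : Fin B → Vec n) (hB : B < 2 ^ l) (hw : w ≤ n)
    {x : ℕ × ℕ} (hx : x ∈ solutions w X) (js : List ℕ) (out : List (ℕ × ℕ)) (τ : ℕ) :
    expectFrom B (load X) (fun o _ => if x ∈ o then 0 else 1) (trials l n B w js)
        (zeroState _) out τ =
      if x ∈ out then 0 else
        (js.map fun j => 1 - hitProb l (solutions w X).card j / (solutions w X).card).prod := by
  induction js generalizing out τ with
  | nil => simp [trials, expectFrom, sqNorm_zeroState]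
  | cons j js ih =>
    rw [trials_cons, expectFrom_trial X hB hw]
    simp only [ih, List.map_cons, List.prod_cons]
    set M := (solutions w X).card with hM
    set p := (js.map fun j => 1 - hitProb l M j / M).prod
    by_cases h : x ∈ out
    · simp [h]
    · have h1 : ∀ ab ∈ solutions w X, (hitProb l M j / M *
          if x ∈ out ++ [ab] then 0 else p) = hitProb l M j / M * p -
            if ab = x then hitProb l M j / M * p else 0 := by
        intro ab _
        by_cases hab : ab = x
        · simp [hab]
        · simp [h, hab, Ne.symm hab]
      rw [Finset.sum_congr rfl h1, Finset.sum_sub_distrib, Finset.sum_const, nsmul_eq_mul,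
        Finset.sum_ite_eq' , if_pos hx, ← hM, if_neg h, if_neg h]
      have h2 := card_mul_hitProb_div l M j
      linear_combination p * h2

open Classical in
/-- A sequence of searches fails to find a `(1 - ε)`-fraction of the solutions with probability
at most the expected fraction of missing solutions, divided by `ε`. -/
lemma le_expectFrom_trials_finds {l B n w : ℕ} (X : Fin B → Vec n) (hB : B < 2 ^ l) (hw : w ≤ n)
    {ε : ℝ} (hε : 0 < ε) (js : List ℕ) (out : List (ℕ × ℕ)) (τ : ℕ)
    (hout : out.toFinset ⊆ solutions w X) :
    1 - (ε * (solutions w X).card)⁻¹ * ∑ x ∈ solutions w X,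
        expectFrom B (load X) (fun o _ => if x ∈ o then 0 else 1) (trials l n B w js)
          (zeroState _) out τ ≤
      expectFrom B (load X) (fun o _ => if Finds w X ε o then 1 else 0) (trials l n B w js)
        (zeroState _) out τ := by
  set M := (solutions w X).card with hM
  induction js generalizing out τ with
  | nil =>
    simp only [trials, List.flatMap_nil, expectFrom, sqNorm_zeroState, one_mul]
    have h1 : (∑ x ∈ solutions w X, if x ∈ out then (0 : ℝ) else 1) =
        M - (out.toFinset.card : ℝ) := by
      have h2 : ∀ x, (if x ∈ out then (0 : ℝ) else 1) =
          1 - if x ∈ out.toFinset then 1 else 0 := by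
        intro x
        by_cases h : x ∈ out <;> simp [h]
      simp only [h2]
      rw [Finset.sum_sub_distrib, Finset.sum_ite_mem, Finset.inter_eq_right.mpr hout]
      simp [hM]
    rw [h1]
    have hcard : (out.toFinset.card : ℝ) ≤ M := by exact_mod_cast Finset.card_le_card hout
    split_ifs with hF
    · have : 0 ≤ (ε * (M : ℝ))⁻¹ * (M - (out.toFinset.card : ℝ)) :=
        mul_nonneg (by positivity) (by linarith)
      linarith
    · have h3 : (out.toFinset.card : ℝ) < (1 - ε) * M := by
        by_contra h3
        exact hF ⟨hout, not_lt.mp h3⟩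
      have hM0 : (0 : ℝ) < M := by
        rcases (Nat.cast_nonneg (α := ℝ) M).lt_or_eq with h | h
        · exact h
        · rw [← h, mul_zero] at h3
          exact absurd h3 (not_lt.mpr (Nat.cast_nonneg _))
      have h4 : 1 ≤ (ε * (M : ℝ))⁻¹ * (M - (out.toFinset.card : ℝ)) := by
        rw [inv_mul_eq_div, le_div_iff₀ (by positivity)]
        linarith
      linarith
  | cons j js ih =>
    simp only [trials_cons, expectFrom_trial X hB hw]
    have h1 := hitProb_le_one l M j
    have h0 := hitProb_nonneg l M j
    have ih1 := mul_le_mul_of_nonneg_left (ih out (τ + trialCost l n B w j) hout)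
      (sub_nonneg.mpr h1)
    have ih2 : ∀ ab ∈ solutions w X, _ := fun ab hab => mul_le_mul_of_nonneg_left
      (ih (out ++ [ab]) (τ + trialCost l n B w j) (by
        rw [List.toFinset_append]
        exact Finset.union_subset hout (by simpa using hab)))
      (by positivity : 0 ≤ hitProb l M j / M)
    refine le_trans (le_of_eq ?_) (add_le_add ih1 (Finset.sum_le_sum ih2))
    have h2 := card_mul_hitProb_div l M j
    generalize (ε * (M : ℝ))⁻¹ = κ
    rw [Finset.sum_add_distrib, ← Finset.mul_sum, Finset.sum_comm]
    simp only [← Finset.mul_sum, mul_left_comm _ κ, mul_sub, mul_one, Finset.sum_sub_distrib,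
      Finset.sum_const, nsmul_eq_mul, ← hM, h2]
    ring

open Classical in
/-- If a given solution is missed with probability at most `δ`, then the sequence of searches
succeeds with probability at least `1 - δ / ε`. -/
lemma le_expectFrom_trials_of_miss_le {l B n w : ℕ} (X : Fin B → Vec n) (hB : B < 2 ^ l)
    (hw : w ≤ n) {ε δ : ℝ} (hε : 0 < ε) (hδ0 : 0 ≤ δ) (js : List ℕ)
    (hδ : 0 < (solutions w X).card →
      (js.map fun j => 1 - hitProb l (solutions w X).card j / (solutions w X).card).prod ≤ δ) :
    1 - δ / ε ≤ expectFrom B (load X) (fun o _ => if Finds w X ε o then 1 else 0)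
      (trials l n B w js) (zeroState _) [] 0 := by
  refine le_trans ?_ (le_expectFrom_trials_finds X hB hw hε js [] 0 (by simp))
  rw [Finset.sum_congr rfl fun x hx => expectFrom_trials_miss X hB hw hx js [] 0]
  simp only [List.not_mem_nil, if_false, Finset.sum_const, nsmul_eq_mul]
  set M := (solutions w X).card with hM
  rcases Nat.eq_zero_or_pos M with h | h
  · have : 0 ≤ δ / ε := by positivity
    simp [h, this]
  · have h1 := hδ h
    have hM0 : (0 : ℝ) < M := by exact_mod_cast h
    have h2 : ∀ t : ℝ, (ε * (M : ℝ))⁻¹ * (M * t) = t / ε := by intro t; field_simp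
    rw [h2]
    gcongr

/-! ### The number of Grover iterations -/

/-- The number of Grover iterations at level `i` satisfies `2 * j + 1 = 3 ^ i`. -/
def levelIterations (i : ℕ) : ℕ := (3 ^ i - 1) / 2

lemma two_mul_levelIterations_add_one (i : ℕ) : 2 * levelIterations i + 1 = 3 ^ i := by
  have h : 3 ^ i % 2 = 1 := by
    rw [Nat.pow_mod]; simp
  unfold levelIterations
  generalize 3 ^ i = t at h ⊢
  omega

/-- For some level `i`, tripling the angle `i` times brings it into the interval `(π/6, π/2]`, so
that a search at this level succeeds with probability at least `1/4`; for this level, `9 ^ i` is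
within constant factors of `4 ^ l / M`. -/
lemma exists_level {l M : ℕ} (hM0 : 0 < M) (hM : M < 2 ^ (2 * l)) :
    ∃ i : ℕ, (M : ℝ) * 9 ^ i ≤ 3 * 2 ^ (2 * l) ∧ (2 : ℝ) ^ (2 * l) ≤ 9 ^ (i + 1) * M ∧
      1 / 4 ≤ hitProb l M (levelIterations i) := by
  have hM0' : (0 : ℝ) < M := by exact_mod_cast hM0
  set θ := groverAngle l M with hθ
  have hsin := sin_groverAngle hM
  rw [← hθ] at hsin
  have hK : (0 : ℝ) < 2 ^ (2 * l) := by positivity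
  have hπ := Real.pi_pos
  have hθ0 : 0 < θ := by
    rw [hθ, groverAngle, Real.arcsin_pos]
    positivity
  have hθ1 : θ ≤ Real.pi / 2 := Real.arcsin_le_pi_div_two _
  have hsq : Real.sin θ ^ 2 = M / 2 ^ (2 * l) := by
    rw [hsin, div_pow, Real.sq_sqrt hM0'.le, Real.sq_sqrt hK.le]
  have hex : ∃ i : ℕ, Real.pi / 6 < 3 ^ i * θ := by
    obtain ⟨i, hi⟩ := pow_unbounded_of_one_lt (Real.pi / 6 / θ) (by norm_num : (1 : ℝ) < 3)
    exact ⟨i, (div_lt_iff₀ hθ0).mp hi⟩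
  classical
  set i := Nat.find hex with hi
  have h1 : Real.pi / 6 < 3 ^ i * θ := Nat.find_spec hex
  have h2 : 3 ^ i * θ ≤ Real.pi / 2 := by
    rcases Nat.eq_zero_or_pos i with h | h
    · rw [h, pow_zero, one_mul]; exact hθ1
    · have h3 := Nat.find_min hex (m := i - 1) (by omega)
      have h4 : (3 : ℝ) ^ i = 3 * 3 ^ (i - 1) := by
        rw [← pow_succ', Nat.sub_add_cancel h]
      rw [h4]
      linarith
  have h9 : (9 : ℝ) ^ i = (3 ^ i) ^ 2 := by rw [← pow_mul, mul_comm, pow_mul]; norm_num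
  have h3i : (0 : ℝ) < 3 ^ i := by positivity
  refine ⟨i, ?_, ?_, ?_⟩
  · have h5 : Real.sin θ * 3 ^ i ≤ Real.pi / 2 := by
      have := Real.sin_le hθ0.le
      nlinarith
    have h6 : 0 ≤ Real.sin θ * 3 ^ i := by rw [hsin]; positivity
    have h7 : (Real.sin θ * 3 ^ i) ^ 2 ≤ (Real.pi / 2) ^ 2 := pow_le_pow_left₀ h6 h5 2
    have h8 : (Real.pi / 2) ^ 2 ≤ 3 := by
      have := Real.pi_lt_d2
      nlinarith
    have h10 : (M : ℝ) / 2 ^ (2 * l) * 9 ^ i ≤ 3 := by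
      rw [← hsq, h9, ← mul_pow]; linarith
    rw [div_mul_eq_mul_div, div_le_iff₀ hK] at h10
    exact h10
  · have h5 : 1 ≤ 3 * (Real.sin θ * 3 ^ i) := by
      have h6 := Real.mul_le_sin hθ0.le hθ1
      have h7 : 2 / Real.pi * (Real.pi / 6) < 2 / Real.pi * (3 ^ i * θ) := by gcongr
      have h8 : 2 / Real.pi * (Real.pi / 6) = 1 / 3 := by field_simp; norm_num
      nlinarith
    have h6 : 1 ≤ (3 * (Real.sin θ * 3 ^ i)) ^ 2 := one_le_pow₀ h5
    have h7 : 1 ≤ 9 * ((M : ℝ) / 2 ^ (2 * l) * 9 ^ i) := by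
      rw [← hsq, h9]; linarith
    have h8 : 9 * ((M : ℝ) / 2 ^ (2 * l) * 9 ^ i) = 9 ^ (i + 1) * M / 2 ^ (2 * l) := by
      rw [pow_succ]; ring
    rw [h8, le_div_iff₀ hK, one_mul] at h7
    exact h7
  · have h5 : (2 * (levelIterations i : ℝ) + 1) = 3 ^ i := by
      exact_mod_cast two_mul_levelIterations_add_one i
    rw [hitProb, ← hθ, h5]
    have h6 : 1 / 2 ≤ Real.sin (3 ^ i * θ) := by
      rw [← Real.sin_pi_div_six]
      exact Real.sin_le_sin_of_le_of_le_pi_div_two (by linarith) h2 h1.le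
    nlinarith

/-! ### The schedule of the searches -/

lemma gateCost_hadamards {n q : ℕ} (I : List (Fin q)) :
    gateCost (hadamards I : List (Gate n q)) = I.length := by
  simp [gateCost, hadamards, Op.cost, Function.comp_def]

lemma gateCost_groverGates_le (l n B w : ℕ) :
    gateCost (groverGates l n B w) ≤ 100 * (2 * l + n + 1) ^ 2 := by
  have h1 := gateCost_testGates_le l n B
  have h2 := gateCost_zeroGates_le l n
  rw [groverGates, diffusionGates, gateCost_append, gateCost_append, gateCost_append,
    gateCost_phaseOracle, gateCost_phaseOracle, gateCost_hadamards, gateCost_hadamards,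
    List.length_reverse, length_addrReg]
  nlinarith [Nat.zero_le l, Nat.zero_le n, Nat.zero_le (l * n), Nat.zero_le (l * l),
    Nat.zero_le (n * n)]

lemma gateCost_flatten_replicate {n q : ℕ} (j : ℕ) (gs : List (Gate n q)) :
    gateCost (List.replicate j gs).flatten = j * gateCost gs := by
  induction j with
  | zero => simp [gateCost]
  | succ j ih =>
    rw [List.replicate_succ, List.flatten_cons, gateCost_append, ih]
    ring

/-- A search with `j` Grover iterations takes `O((2 * j + 1) * (l + n) ^ 2)` steps. -/
lemma trialCost_le (l n B w j : ℕ) :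
    trialCost l n B w j ≤ 100 * (2 * j + 1) * (2 * l + n + 1) ^ 2 := by
  have h1 := gateCost_testGates_le l n B
  have h2 := Nat.mul_le_mul_left j (gateCost_groverGates_le l n B w)
  rw [trialCost, searchGates, gateCost_append, gateCost_append, gateCost_flatten_replicate,
    gateCost_hadamards, length_addrReg]
  have h5 := numQubits_eq l n
  have h3 : 2 * l + 20 * (2 * l + n + 1) ^ 2 + (1 + l + l) +
      (2 * l + (n + (2 * l + n + 1) * (8 * (n + 1)))) ≤ 100 * (2 * l + n + 1) ^ 2 := by
    nlinarith [Nat.zero_le l, Nat.zero_le n, Nat.zero_le (l * n), Nat.zero_le (l * l),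
      Nat.zero_le (n * n)]
  have h4 : j * (100 * (2 * l + n + 1) ^ 2) + 100 * (2 * l + n + 1) ^ 2 ≤
      100 * (2 * j + 1) * (2 * l + n + 1) ^ 2 := by
    have : 0 ≤ j * (2 * l + n + 1) ^ 2 := Nat.zero_le _
    nlinarith
  omega

/-- The number of searches at level `i`. For numbers `M` of solutions with `M * 9 ^ i ≤ 3 * 4 ^ l`,
this is at least `8 * (n + 1) * M`. -/
noncomputable def levelTrials (l n i : ℕ) : ℕ := ⌈24 * ((n : ℝ) + 1) * 2 ^ (2 * l) / 9 ^ i⌉₊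

open Classical in
/-- The levels that are the right ones for some number of solutions between `1` and `m`. -/
noncomputable def levels (l : ℕ) (m : ℝ) : List ℕ :=
  (List.range (l + 2)).filter fun i =>
    (9 : ℝ) ^ i ≤ 3 * 2 ^ (2 * l) ∧ (2 : ℝ) ^ (2 * l) ≤ 9 ^ (i + 1) * m

/-- The numbers of Grover iterations of all searches, for at most `m` solutions. -/
noncomputable def schedule (l n : ℕ) (m : ℝ) : List ℕ :=
  (levels l m).flatMap fun i => List.replicate (levelTrials l n i) (levelIterations i)

lemma mem_levels {l i : ℕ} {m : ℝ} : i ∈ levels l m ↔ i < l + 2 ∧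
    (9 : ℝ) ^ i ≤ 3 * 2 ^ (2 * l) ∧ (2 : ℝ) ^ (2 * l) ≤ 9 ^ (i + 1) * m := by
  simp [levels]

lemma sum_map_schedule (l n : ℕ) (m : ℝ) (f : ℕ → ℝ) :
    ((schedule l n m).map f).sum =
      ((levels l m).map fun i => levelTrials l n i * f (levelIterations i)).sum := by
  unfold schedule
  generalize levels l m = L
  induction L with
  | nil => rfl
  | cons i L ih => simp [ih]

lemma prod_one_sub_le_exp (js : List ℕ) (f : ℕ → ℝ) (hf : ∀ j, f j ≤ 1) :
    0 ≤ (js.map fun j => 1 - f j).prod ∧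
      (js.map fun j => 1 - f j).prod ≤ Real.exp (-(js.map f).sum) := by
  induction js with
  | nil => simp
  | cons j js ih =>
    simp only [List.map_cons, List.prod_cons, List.sum_cons]
    have h1 : 0 ≤ 1 - f j := by linarith [hf j]
    refine ⟨mul_nonneg h1 ih.1, ?_⟩
    rw [neg_add, Real.exp_add]
    refine mul_le_mul ?_ ih.2 ih.1 (Real.exp_pos _).le
    linarith [Real.add_one_le_exp (-f j)]

/-- If there are at most `m` solutions, each of them is missed by the whole schedule with
probability at most `1 / (n + 1) ^ 2`. -/
lemma prod_schedule_le {l n M : ℕ} {m : ℝ} (hM0 : 0 < M) (hM : M < 2 ^ (2 * l)) (hMm : M ≤ m) :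
    ((schedule l n m).map fun j => 1 - hitProb l M j / M).prod ≤ 1 / ((n : ℝ) + 1) ^ 2 := by
  have hM1 : (1 : ℝ) ≤ M := by exact_mod_cast hM0
  obtain ⟨i, h1, h2, h3⟩ := exists_level hM0 hM
  have h9 : (0 : ℝ) < 9 ^ i := by positivity
  have h9K : (9 : ℝ) ^ i ≤ 3 * 2 ^ (2 * l) := by nlinarith
  have hi : i ∈ levels l m := by
    refine mem_levels.mpr ⟨?_, h9K, h2.trans (by gcongr)⟩
    by_contra hcon
    have h4 : (9 : ℝ) ^ (l + 2) ≤ 9 ^ i := pow_le_pow_right₀ (by norm_num) (not_lt.mp hcon)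
    have h5 : (2 : ℝ) ^ (2 * l) ≤ 9 ^ l := by
      rw [pow_mul]
      exact pow_le_pow_left₀ (by norm_num) (by norm_num) l
    have h6 : (0 : ℝ) < 9 ^ l := by positivity
    rw [pow_add] at h4
    linarith
  have hle : ∀ j, hitProb l M j / M ≤ 1 := fun j => by
    rw [div_le_one (by linarith)]
    exact (hitProb_le_one l M j).trans hM1
  have hν : (0 : ℝ) < (n : ℝ) + 1 := by positivity
  have hT : 2 * ((n : ℝ) + 1) ≤ ((schedule l n m).map fun j => hitProb l M j / M).sum := by
    rw [sum_map_schedule]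
    have h4 : (levelTrials l n i : ℝ) * (hitProb l M (levelIterations i) / M) ≤
        ((levels l m).map fun i =>
          (levelTrials l n i : ℝ) * (hitProb l M (levelIterations i) / M)).sum := by
      refine List.single_le_sum ?_ _ (List.mem_map.mpr ⟨i, hi, rfl⟩)
      intro x hx
      obtain ⟨k, -, rfl⟩ := List.mem_map.mp hx
      have := hitProb_nonneg l M (levelIterations k)
      positivity
    refine le_trans ?_ h4
    have h5 : 24 * ((n : ℝ) + 1) * 2 ^ (2 * l) / 9 ^ i ≤ levelTrials l n i := Nat.le_ceil _
    have h6 : 8 * ((n : ℝ) + 1) * M ≤ 24 * ((n : ℝ) + 1) * 2 ^ (2 * l) / 9 ^ i := by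
      rw [le_div_iff₀ h9]
      nlinarith
    have h7 : 1 / 4 / (M : ℝ) ≤ hitProb l M (levelIterations i) / M := by gcongr
    calc 2 * ((n : ℝ) + 1) = 8 * ((n : ℝ) + 1) * M * (1 / 4 / (M : ℝ)) := by
          field_simp; norm_num
      _ ≤ levelTrials l n i * (hitProb l M (levelIterations i) / M) :=
          mul_le_mul (h6.trans h5) h7 (by positivity) (Nat.cast_nonneg _)
  refine ((prod_one_sub_le_exp _ _ hle).2.trans
    (Real.exp_le_exp.mpr (neg_le_neg hT))).trans ?_
  rw [Real.exp_neg, one_div]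
  refine inv_anti₀ (by positivity) ?_
  rw [two_mul, Real.exp_add, sq]
  have h8 : (n : ℝ) + 1 ≤ Real.exp ((n : ℝ) + 1) := by
    linarith [Real.add_one_le_exp ((n : ℝ) + 1)]
  exact mul_le_mul h8 h8 hν.le (Real.exp_pos _).le

/-- The total time of the schedule is `(2 ^ l) * √m` up to polynomial factors. -/
lemma sum_trialCost_schedule_le (l n B w : ℕ) (m : ℝ) :
    ((schedule l n m).map fun j => (trialCost l n B w j : ℝ)).sum ≤
      ((l : ℝ) + 2) * (8100 * (2 * l + n + 1) ^ 2 * (n + 1) * Real.sqrt (2 ^ (2 * l) * m)) := by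
  rw [sum_map_schedule]
  set s : ℝ := 2 * l + n + 1 with hs
  set ν : ℝ := (n : ℝ) + 1 with hν
  set K : ℝ := 2 ^ (2 * l) with hK
  have hK0 : 0 < K := by positivity
  have hν1 : 1 ≤ ν := by rw [hν]; linarith [Nat.cast_nonneg (α := ℝ) n]
  have hb : ∀ x ∈ ((levels l m).map fun i =>
      (levelTrials l n i : ℝ) * (trialCost l n B w (levelIterations i) : ℝ)),
      x ≤ 8100 * s ^ 2 * ν * Real.sqrt (K * m) := by
    intro x hx
    obtain ⟨i, hi, rfl⟩ := List.mem_map.mp hx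
    obtain ⟨-, h1, h2⟩ := mem_levels.mp hi
    rw [← hK] at h1 h2
    have h3 : (0 : ℝ) < 3 ^ i := by positivity
    have h9 : (9 : ℝ) ^ i = 3 ^ i * 3 ^ i := by rw [← mul_pow]; norm_num
    have h90 : (0 : ℝ) < 9 ^ i := by positivity
    have hT : (levelTrials l n i : ℝ) * 9 ^ i ≤ 27 * ν * K := by
      have h4 : (levelTrials l n i : ℝ) ≤ 24 * ν * K / 9 ^ i + 1 :=
        (Nat.ceil_lt_add_one (by positivity)).le
      have h5 : (24 * ν * K / 9 ^ i + 1) * 9 ^ i = 24 * ν * K + 9 ^ i := by field_simp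
      nlinarith
    have hc : (trialCost l n B w (levelIterations i) : ℝ) ≤ 100 * 3 ^ i * s ^ 2 := by
      have h4 := trialCost_le l n B w (levelIterations i)
      rw [two_mul_levelIterations_add_one] at h4
      have h5 : (trialCost l n B w (levelIterations i) : ℝ) ≤
          ((100 * 3 ^ i * (2 * l + n + 1) ^ 2 : ℕ) : ℝ) := by exact_mod_cast h4
      push_cast at h5
      exact h5
    -- the choice of the levels bounds `K` by `3 * 3 ^ i * √(K * m)`
    have hr : K ≤ 3 * 3 ^ i * Real.sqrt (K * m) := by
      have h4 : K * K ≤ (3 * 3 ^ i) ^ 2 * (K * m) := by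
        have h5 : K * K ≤ K * (9 ^ (i + 1) * m) := by gcongr
        rw [pow_succ, h9] at h5
        linarith
      calc K = Real.sqrt (K * K) := (Real.sqrt_mul_self hK0.le).symm
        _ ≤ Real.sqrt ((3 * 3 ^ i) ^ 2 * (K * m)) := Real.sqrt_le_sqrt h4
        _ = 3 * 3 ^ i * Real.sqrt (K * m) := by
            rw [Real.sqrt_mul (by positivity), Real.sqrt_sq (by positivity)]
    have hT' : (levelTrials l n i : ℝ) * 3 ^ i ≤ 81 * ν * Real.sqrt (K * m) := by
      have h5 : (levelTrials l n i : ℝ) * 3 ^ i * 3 ^ i ≤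
          81 * ν * Real.sqrt (K * m) * 3 ^ i := by
        rw [mul_assoc, ← h9]
        refine hT.trans ?_
        have : 27 * ν * K ≤ 27 * ν * (3 * 3 ^ i * Real.sqrt (K * m)) := by gcongr
        linarith
      exact le_of_mul_le_mul_right h5 h3
    calc (levelTrials l n i : ℝ) * (trialCost l n B w (levelIterations i) : ℝ)
        ≤ levelTrials l n i * (100 * 3 ^ i * s ^ 2) := by gcongr
      _ = 100 * s ^ 2 * (levelTrials l n i * 3 ^ i) := by ring
      _ ≤ 100 * s ^ 2 * (81 * ν * Real.sqrt (K * m)) := by gcongr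
      _ = 8100 * s ^ 2 * ν * Real.sqrt (K * m) := by ring
  refine (List.sum_le_card_nsmul _ _ hb).trans ?_
  rw [nsmul_eq_mul, List.length_map]
  have hlen : ((levels l m).length : ℝ) ≤ (l : ℝ) + 2 := by
    have h1 : (levels l m).length ≤ l + 2 := by
      simpa [levels] using List.length_filter_le _ (List.range (l + 2))
    exact_mod_cast h1
  have : 0 ≤ 8100 * s ^ 2 * ν * Real.sqrt (K * m) := by positivity
  gcongr

/-! ### Growth estimates -/

lemma half_lt_log_two_add {x : ℝ} (hx : 0 ≤ x) : 1 / 2 < Real.log (2 + x) := by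
  have h1 : Real.log 2 ≤ Real.log (2 + x) := Real.log_le_log (by norm_num) (by linarith)
  linarith [Real.log_two_gt_d9]

lemma size_le_log (B : ℕ) : (Nat.size B : ℝ) ≤ 4 * Real.log (2 + (B : ℝ)) := by
  have h0 := half_lt_log_two_add (Nat.cast_nonneg (α := ℝ) B)
  rcases Nat.eq_zero_or_pos (Nat.size B) with h | h
  · rw [h, Nat.cast_zero]; linarith
  · have h1 : 2 ^ (Nat.size B - 1) ≤ B := Nat.lt_size.mp (by omega)
    have h2 : (2 : ℝ) ^ (Nat.size B - 1) ≤ 2 + (B : ℝ) := by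
      have : ((2 ^ (Nat.size B - 1) : ℕ) : ℝ) ≤ B := by exact_mod_cast h1
      push_cast at this
      linarith
    have h3 := Real.log_le_log (by positivity) h2
    rw [Real.log_pow, Nat.cast_sub h, Nat.cast_one] at h3
    have h4 : (1 : ℝ) ≤ Nat.size B := by exact_mod_cast h
    nlinarith [Real.log_two_gt_d9]

lemma two_pow_size_le {B : ℕ} (hB : 0 < B) : (2 : ℝ) ^ (2 * Nat.size B) ≤ 4 * (B : ℝ) ^ 2 := by
  have h : 0 < Nat.size B := Nat.size_pos.mpr hB
  have h1 : 2 ^ (Nat.size B - 1) ≤ B := Nat.lt_size.mp (by omega)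
  have h2 : ((2 ^ (Nat.size B - 1) : ℕ) : ℝ) ≤ B := by exact_mod_cast h1
  push_cast at h2
  have h3 : (2 : ℝ) ^ (2 * Nat.size B) = 4 * ((2 : ℝ) ^ (Nat.size B - 1)) ^ 2 := by
    obtain ⟨k, hk⟩ : ∃ k, Nat.size B = k + 1 := ⟨Nat.size B - 1, by omega⟩
    rw [hk, Nat.add_sub_cancel]
    ring
  rw [h3]
  gcongr

/-- The number of qubits is polynomial in `n` and `log B`. -/
lemma numQubits_le (B n : ℕ) :
    (numQubits (Nat.size B) n : ℝ) ≤ 10 ^ 8 * ((n : ℝ) + Real.log (2 + (B : ℝ))) ^ 5 := by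
  have h1 := size_le_log B
  have h0 := half_lt_log_two_add (Nat.cast_nonneg (α := ℝ) B)
  set l := Nat.size B
  set Λ := (n : ℝ) + Real.log (2 + (B : ℝ)) with hΛ
  have hn : (0 : ℝ) ≤ n := Nat.cast_nonneg n
  have hl : (0 : ℝ) ≤ l := Nat.cast_nonneg l
  have hs : 2 * (l : ℝ) + n + 1 ≤ 10 * Λ := by rw [hΛ]; linarith
  have hΛ0 : 1 / 2 ≤ Λ := by rw [hΛ]; linarith
  rw [numQubits_eq]
  push_cast
  calc 2 * (l : ℝ) + (n + (2 * l + n + 1) * (8 * (n + 1))) ≤ 9 * (2 * l + n + 1) ^ 2 := by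
        nlinarith [mul_nonneg hn hl, mul_nonneg hn hn, mul_nonneg hl hl]
    _ ≤ 9 * (10 * Λ) ^ 2 := by gcongr
    _ = 7200 * Λ ^ 2 * (1 / 2) ^ 3 := by ring
    _ ≤ 7200 * Λ ^ 2 * Λ ^ 3 := by gcongr
    _ ≤ 10 ^ 8 * Λ ^ 5 := by
        have : 0 ≤ Λ ^ 5 := by positivity
        nlinarith

/-- The time of the schedule is `B² √p` up to a factor polynomial in `n` and `log (B² √p)`,
provided that `(n + 1) B² p ≥ 1`. -/
lemma time_bound {B n w : ℕ} {p : ℝ} (hp : 1 ≤ ((n : ℝ) + 1) * ((B : ℝ) ^ 2 * p)) :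
    ((schedule (Nat.size B) n (((n : ℝ) + 1) * ((B : ℝ) ^ 2 * p))).map fun j =>
        (trialCost (Nat.size B) n B w j : ℝ)).sum ≤
      10 ^ 8 * ((B : ℝ) ^ 2 * Real.sqrt p) *
        ((n : ℝ) + Real.log (2 + (B : ℝ) ^ 2 * Real.sqrt p)) ^ 5 := by
  have hn : (0 : ℝ) ≤ n := Nat.cast_nonneg n
  set ν : ℝ := (n : ℝ) + 1 with hν
  have hν1 : 1 ≤ ν := by rw [hν]; linarith
  have hB : 0 < B := by
    rcases Nat.eq_zero_or_pos B with h | h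
    · simp [h] at hp; linarith
    · exact h
  have hB0 : (0 : ℝ) < B := by exact_mod_cast hB
  have hp0 : 0 < p := by
    by_contra h
    have h1 : (B : ℝ) ^ 2 * p ≤ 0 := mul_nonpos_of_nonneg_of_nonpos (by positivity) (not_lt.mp h)
    nlinarith
  refine (sum_trialCost_schedule_le (Nat.size B) n B w _).trans ?_
  set f := (B : ℝ) ^ 2 * Real.sqrt p with hf
  have hf0 : 0 < f := mul_pos (by positivity) (Real.sqrt_pos.mpr hp0)
  have hνf : ∀ a : ℝ, 0 ≤ a → Real.sqrt (a ^ 2 * (B : ℝ) ^ 2 * (ν * ((B : ℝ) ^ 2 * p))) =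
      a * Real.sqrt ν * f := by
    intro a ha
    rw [show a ^ 2 * (B : ℝ) ^ 2 * (ν * ((B : ℝ) ^ 2 * p)) = (a * (B : ℝ) ^ 2) ^ 2 * (ν * p) by
      ring, Real.sqrt_mul (by positivity), Real.sqrt_sq (by positivity),
      Real.sqrt_mul (by positivity), hf]
    ring
  have hsν : Real.sqrt ν ≤ ν := by
    rw [Real.sqrt_le_left (by linarith)]
    nlinarith
  have hsq : Real.sqrt (2 ^ (2 * Nat.size B) * (ν * ((B : ℝ) ^ 2 * p))) ≤ 2 * ν * f := by
    have h1 : (2 : ℝ) ^ (2 * Nat.size B) * (ν * ((B : ℝ) ^ 2 * p)) ≤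
        2 ^ 2 * (B : ℝ) ^ 2 * (ν * ((B : ℝ) ^ 2 * p)) := by
      have := two_pow_size_le hB
      gcongr
      linarith
    refine (Real.sqrt_le_sqrt h1).trans ?_
    rw [hνf 2 (by norm_num)]
    gcongr
  -- this turns the logarithm of `B` into one of `f`
  have hBf : (B : ℝ) ≤ ν * f := by
    have h1 : (B : ℝ) ^ 2 ≤ 1 ^ 2 * (B : ℝ) ^ 2 * (ν * ((B : ℝ) ^ 2 * p)) := by
      have : (0 : ℝ) < (B : ℝ) ^ 2 := by positivity
      nlinarith
    have h2 := Real.sqrt_le_sqrt h1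
    rw [Real.sqrt_sq hB0.le, hνf 1 (by norm_num), one_mul] at h2
    exact h2.trans (by gcongr)
  set Λ := (n : ℝ) + Real.log (2 + f) with hΛ
  have hΛ0 := half_lt_log_two_add hf0.le
  have hlog : Real.log (2 + (B : ℝ)) ≤ Λ := by
    have h1 : 2 + (B : ℝ) ≤ ν * (2 + f) := by nlinarith
    have h2 := Real.log_le_log (by linarith) h1
    rw [Real.log_mul (by linarith) (by linarith)] at h2
    have h3 : Real.log ν ≤ ν - 1 := Real.log_le_sub_one_of_pos (by linarith)
    rw [hΛ]
    linarith
  have hl := size_le_log B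
  have hΛ1 : 1 / 2 ≤ Λ := by rw [hΛ]; linarith
  have hνΛ : ν ≤ 2 * Λ := by rw [hΛ, hν]; linarith
  have hl0 : (0 : ℝ) ≤ Nat.size B := Nat.cast_nonneg _
  have hs : 2 * (Nat.size B : ℝ) + n + 1 ≤ 10 * Λ := by linarith
  have hl2 : (Nat.size B : ℝ) + 2 ≤ 8 * Λ := by linarith
  calc ((Nat.size B : ℝ) + 2) * (8100 * (2 * (Nat.size B : ℝ) + n + 1) ^ 2 * ν *
        Real.sqrt (2 ^ (2 * Nat.size B) * (ν * ((B : ℝ) ^ 2 * p))))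
      ≤ (8 * Λ) * (8100 * (10 * Λ) ^ 2 * (2 * Λ) * (2 * (2 * Λ) * f)) := by
        have h3 : Real.sqrt (2 ^ (2 * Nat.size B) * (ν * ((B : ℝ) ^ 2 * p))) ≤
            2 * (2 * Λ) * f := hsq.trans (by gcongr)
        gcongr
    _ = 51840000 * f * Λ ^ 5 := by ring
    _ ≤ 10 ^ 8 * f * Λ ^ 5 := by
        have : 0 ≤ f * Λ ^ 5 := by positivity
        nlinarith

/-! ### The algorithms -/

/-- The algorithm that does nothing. -/
def idleAlgorithm (B n : ℕ) : QAlgorithm n := ⟨0, B, []⟩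

/-- The algorithm that runs the schedule for at most `m` solutions. -/
noncomputable def groverAlgorithm (B n w : ℕ) (m : ℝ) : QAlgorithm n :=
  ⟨numQubits (Nat.size B) n, B,
    trials (Nat.size B) n B w (schedule (Nat.size B) n m)⟩

lemma expectedTime_idleAlgorithm {n : ℕ} (B w α : ℕ) (c : Vec n) :
    (idleAlgorithm B n).expectedTime B w α c = 0 := by
  simp [QAlgorithm.expectedTime, QAlgorithm.expect, idleAlgorithm, expectFrom]

open Classical in
/-- Doing nothing succeeds if there is no solution, so with probability at least `1 - B² p`. -/
lemma successProb_idleAlgorithm {n : ℕ} (B w α : ℕ) {c : Vec n} (h : (region w α c).Nonempty)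
    (ε : ℝ) :
    1 - (B : ℝ) ^ 2 * solutionProb w α c ≤ (idleAlgorithm B n).successProb B w α c ε := by
  have h1 := le_expect_of_few_solutions B h one_pos le_rfl
    (fun X => (idleAlgorithm B n).expect X fun out _ => if Finds w X ε out then 1 else 0)
    (fun X => ?_) (fun X hX => ?_)
  · simpa [QAlgorithm.successProb] using h1
  · simp only [QAlgorithm.expect, idleAlgorithm, expectFrom, sqNorm_zeroState, one_mul]
    split_ifs <;> norm_num
  · have h2 : solutions w X = ∅ := by
      rw [← Finset.card_eq_zero]
      have : (solutions w X).card < 1 := by exact_mod_cast hX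
      omega
    have h3 : Finds w X ε [] := by simp [Finds, h2]
    simp [QAlgorithm.expect, idleAlgorithm, expectFrom, sqNorm_zeroState, h3]

lemma expectedTime_groverAlgorithm {n : ℕ} (B : ℕ) {w α : ℕ} (hw : w ≤ n) {c : Vec n}
    (h : (region w α c).Nonempty) (m : ℝ) :
    (groverAlgorithm B n w m).expectedTime B w α c =
      ((schedule (Nat.size B) n m).map fun j => (trialCost (Nat.size B) n B w j : ℝ)).sum := by
  have h1 : ∀ X : Fin B → Vec n,
      (groverAlgorithm B n w m).expect X (fun _ τ => (τ : ℝ)) =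
      ((schedule (Nat.size B) n m).map fun j => (trialCost (Nat.size B) n B w j : ℝ)).sum := by
    intro X
    have h2 := expectFrom_trials_time X (Nat.lt_size_self B) hw (schedule (Nat.size B) n m) [] 0
    rw [Nat.cast_zero, zero_add] at h2
    exact h2
  simp only [QAlgorithm.expectedTime, h1]
  exact Finset.expect_const (bucketLists_nonempty B h) _

open Classical in
/-- The schedule succeeds with probability at least `1 - 2 / (n + 1)`: half of the error bounds the
probability of more than `(n + 1) B² p` solutions, the rest that of missing too many of them. -/
lemma successProb_groverAlgorithm {n : ℕ} (B : ℕ) {w α : ℕ} (hw : w ≤ n) {c : Vec n}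
    (h : (region w α c).Nonempty)
    (hm : 0 < ((n : ℝ) + 1) * ((B : ℝ) ^ 2 * solutionProb w α c)) :
    1 - 2 / ((n : ℝ) + 1) ≤
      (groverAlgorithm B n w (((n : ℝ) + 1) * ((B : ℝ) ^ 2 * solutionProb w α c))).successProb
        B w α c (2 / ((n : ℝ) + 1)) := by
  set ν : ℝ := (n : ℝ) + 1 with hν
  have hν0 : 0 < ν := by positivity
  set μ := (B : ℝ) ^ 2 * solutionProb w α c with hμ
  have hμ0 : 0 < μ := (mul_pos_iff_of_pos_left hν0).mp hm
  have hB := Nat.lt_size_self B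
  have h1 := le_expect_of_few_solutions B h hm (δ := 1 / ν) (by positivity)
    (fun X => (groverAlgorithm B n w (ν * μ)).expect X fun out _ =>
      if Finds w X (2 / ν) out then 1 else 0) (fun X => ?_) (fun X hX => ?_)
  · refine le_trans (le_of_eq ?_) h1
    rw [← hμ]
    field_simp
    ring
  · exact expectFrom_trials_nonneg X hB hw (fun out τ => by split_ifs <;> norm_num) _ _ _
  · have h2 := le_expectFrom_trials_of_miss_le X hB hw (ε := 2 / ν) (δ := 1 / ν ^ 2)
      (by positivity) (by positivity) (schedule (Nat.size B) n (ν * μ))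
      fun hM => prod_schedule_le hM (card_solutions_lt X hB) hX.le
    refine le_trans ?_ h2
    have h3 : 1 / ν ^ 2 / (2 / ν) = 1 / ν / 2 := by field_simp
    have h4 : 0 < 1 / ν := by positivity
    rw [h3]
    linarith

end BucketSearch

theorem mainTheorem2 :
    ∃ (C : ℝ) (k : ℕ) (ε : ℕ → ℝ), Tendsto ε atTop (𝓝 0) ∧
      ∀ B n w v α : ℕ, ∃ A : BucketSearch.QAlgorithm n,
        A.words = B ∧
        (A.qubits : ℝ) ≤ C * ((n : ℝ) + Real.log (2 + (B : ℝ))) ^ k ∧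
        ∀ c ∈ BucketSearch.sphere n v, (BucketSearch.region w α c).Nonempty →
          1 - ε n ≤ A.successProb B w α c (ε n) ∧
          A.expectedTime B w α c ≤
            C * ((B : ℝ) ^ 2 * Real.sqrt (BucketSearch.solutionProb w α c)) *
              ((n : ℝ) + Real.log
                (2 + (B : ℝ) ^ 2 * Real.sqrt (BucketSearch.solutionProb w α c))) ^ k := by
  refine ⟨10 ^ 8, 5, fun n => 2 / ((n : ℝ) + 1), ?_, fun B n w v α => ?_⟩
  · have h := (tendsto_one_div_add_atTop_nhds_zero_nat (𝕜 := ℝ)).const_mul 2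
    simpa only [mul_one_div, mul_zero] using h
  have hlogB := BucketSearch.half_lt_log_two_add (Nat.cast_nonneg (α := ℝ) B)
  have hn : (0 : ℝ) ≤ n := Nat.cast_nonneg n
  by_cases hex : ∃ c ∈ BucketSearch.sphere n v, (BucketSearch.region w α c).Nonempty ∧
      1 ≤ ((n : ℝ) + 1) * ((B : ℝ) ^ 2 * BucketSearch.solutionProb w α c)
  · obtain ⟨c₀, hc₀, hne₀, hp₀⟩ := hex
    have hw : w ≤ n := by
      obtain ⟨x, hx⟩ := hne₀
      simp only [BucketSearch.region, BucketSearch.sphere, Finset.mem_filter] at hx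
      rw [← hx.1.2]
      simpa using hammingNorm_le_card_fintype (x := x)
    refine ⟨BucketSearch.groverAlgorithm B n w
      (((n : ℝ) + 1) * ((B : ℝ) ^ 2 * BucketSearch.solutionProb w α c₀)), rfl,
      BucketSearch.numQubits_le B n, fun c hc hne => ?_⟩
    have hcc : BucketSearch.solutionProb w α c₀ = BucketSearch.solutionProb w α c := by
      simp only [BucketSearch.sphere, Finset.mem_filter] at hc hc₀
      exact BucketSearch.solutionProb_eq_of_hammingNorm_eq w α (hc₀.2.trans hc.2.symm)
    rw [hcc] at hp₀ ⊢
    refine ⟨BucketSearch.successProb_groverAlgorithm B hw hne (by linarith), ?_⟩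
    rw [BucketSearch.expectedTime_groverAlgorithm B hw hne]
    exact BucketSearch.time_bound hp₀
  · refine ⟨BucketSearch.idleAlgorithm B n, rfl, ?_, fun c hc hne => ⟨?_, ?_⟩⟩
    · have h1 : ((BucketSearch.idleAlgorithm B n).qubits : ℝ) = 0 := Nat.cast_zero
      rw [h1]
      positivity
    · have h1 : ((n : ℝ) + 1) * ((B : ℝ) ^ 2 * BucketSearch.solutionProb w α c) < 1 := by
        by_contra h
        exact hex ⟨c, hc, hne, not_lt.mp h⟩
      have h2 : (B : ℝ) ^ 2 * BucketSearch.solutionProb w α c ≤ 2 / ((n : ℝ) + 1) := by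
        rw [le_div_iff₀ (by positivity)]
        linarith
      linarith [BucketSearch.successProb_idleAlgorithm B w α hne (2 / ((n : ℝ) + 1))]
    · rw [BucketSearch.expectedTime_idleAlgorithm]
      have h1 := BucketSearch.half_lt_log_two_add
        (x := (B : ℝ) ^ 2 * Real.sqrt (BucketSearch.solutionProb w α c)) (by positivity)
      positivity
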